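/- Let $\mathbf k$ be a field of characteristic $0$, let $H$ be a cocommutative Hopf algebra over $\mathbf k$, and let all modules be left $H$-modules. **Pseudotensors.** For an $H$-module $N$ and $p\ge 1$ let $H^{\otimes p}\otimes_H N$ be the left $H^{\otimes p}$-module in which $H$ acts on $H^{\otimes p}$ from the right through the iterated coproduct. A *pseudoproduct* with $p$ arguments from $M$ to $N$ is an $H^{\otimes p}$-linear map $f:M^{\otimes p}\to H^{\otimes p}\otimes_H N$. For a permutation $\sigma$ let $\sigma\otimes_H\mathrm{id}$ be the map that moves the $i$-th factor of $H^{\otimes p}$ to position $\sigma(i)$. Let $C^p(M,N)$ be the space of pseudoproducts that are skew-symmetric: $f(x_1,\dots,x_p)=(-1)^{\sigma}(\sigma\otimes_H\mathrm{id})f(x_{\sigma(1)},\dots,x_{\sigma(p)})$ for all $\sigma\in S_p$. An $H$-linear map $T:M\to N$ is regarded as the element $x\mapsto 1\otimes_H T(x)$ of $C^1(M,N)$, and $T$ also denotes the map $\mathrm{id}\otimes_H T$ on pseudotensors. A pseudotensor may be put into the first argument of a pseudoproduct by $f\big(F\otimes_H a,y_1,\dots,y_m\big)=(F\otimes 1^{\otimes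 m})\,\big((\Delta^{(q-1)}\otimes\mathrm{id}^{\otimes m})\otimes_H\mathrm{id}\big)f(a,y_1,\dots,y_m)$ for $F\in H^{\otimes q}$, where $\Delta^{(q-1)}:H\to H^{\otimes q}$ is the iterated coproduct, and similarly for the other arguments. **Lie pseudoalgebras.** A Lie $H$-pseudoalgebra is an $H$-module $L$ with a pseudobracket $[\cdot*\cdot]\in C^2(L,L)$ such that $[a*[b*c]]=[[a*b]*c]+((12)\otimes_H\mathrm{id})[b*[a*c]]$ in $H^{\otimes 3}\otimes_H L$ for all $a,b,c\in L$. **Quasi-twilled Lie pseudoalgebras.** A quasi-twilled Lie pseudoalgebra $(\mathfrak G,\mathfrak g,\mathfrak h)$ consists of $H$-modules $\mathfrak g,\mathfrak h$ and a Lie pseudoalgebra structure $\Omega$ on $\mathfrak G=\mathfrak g\oplus\mathfrak h$ for which $\mathfrak h$ is a subpseudoalgebra, that is, $\Omega(u,v)\in H^{\otimes2}\otimes_H\mathfrak h$ for $u,v\in\mathfrak h$. Its components are $$\pi:\mathfrak g\otimes\mathfrak g\to H^{\otimes2}\otimes_H\mathfrak g,\quad \theta:\mathfrak g\otimes\mathfrak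 g\to H^{\otimes2}\otimes_H\mathfrak h,\quad \eta:\mathfrak g\otimes\mathfrak h\to H^{\otimes2}\otimes_H\mathfrak g,\quad \rho:\mathfrak g\otimes\mathfrak h\to H^{\otimes2}\otimes_H\mathfrak h,\quad \mu:\mathfrak h\otimes\mathfrak h\to H^{\otimes2}\otimes_H\mathfrak h .$$ A *deformation map of type II* is an $H$-linear map $T:\mathfrak h\to\mathfrak g$ such that for all $u,v\in\mathfrak h$ $$\pi(Tu,Tv)+\eta(Tu,v)-((12)\otimes_H\mathrm{id})\,\eta(Tv,u)=T\Big(\rho(Tu,v)-((12)\otimes_H\mathrm{id})\,\rho(Tv,u)+\mu(u,v)+\theta(Tu,Tv)\Big).$$ **Brackets.** For pseudoproducts $f,g$ from $\mathfrak G$ to $\mathfrak G$ with $p$ and $q$ arguments put $$(f\circledcirc g)(x_1,\dots,x_{p+q-1})=\sum_{\sigma}(-1)^{\sigma}(\sigma\otimes_H\mathrm{id})\,f\big(g(x_{\sigma(1)},\dots,x_{\sigma(q)}),x_{\sigma(q+1)},\dots,x_{\sigma(p+q-1)}\big),$$ the sum being over the permutations $\sigma$ that are increasing on $\{1,\dots,q\}$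 and on $\{q+1,\dots,p+q-1\}$, and $[f,g]_{NR}=f\circledcirc g-(-1)^{(p-1)(q-1)}g\circledcirc f$. The components of $\Omega$ and the cochains $f\in C^p(\mathfrak h,\mathfrak g)$ are identified with pseudoproducts on $\mathfrak G$: $\pi,\theta,\mu,f$ are applied to the relevant components of the arguments, while $\eta$ stands for $((x,u),(y,v))\mapsto\eta(x,v)-((12)\otimes_H\mathrm{id})\,\eta(y,u)$, and likewise for $\rho$. For cochains $f,g,e$ in $\bigoplus_{n\ge0}C^{n+1}(\mathfrak h,\mathfrak g)$ put $$l_1(f)=[\mu+\eta,f]_{NR},\quad l_2(f,g)=[[\pi+\rho,f]_{NR},g]_{NR},\quad l_3(f,g,e)=[[[\theta,f]_{NR},g]_{NR},e]_{NR},$$ and, for an $H$-linear map $T:\mathfrak h\to\mathfrak g$, $$l_1^T(f)=l_1(f)+l_2(T,f)+\tfrac12\,l_3(T,T,f),\qquad l_2^T(f,g)=l_2(f,g)+l_3(T,f,g),\qquad l_3^T(f,g,e)=l_3(f,g,e).$$ **Theorem.** Let $T$ be a deformation map of type II of the quasi-twilled Lie pseudoalgebra $(\mathfrak G,\mathfrak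 g,\mathfrak h)$, and let $T':\mathfrak h\to\mathfrak g$ be an $H$-linear map. Then $T+T'$ is a deformation map of type II of $(\mathfrak G,\mathfrak g,\mathfrak h)$ if and only if $T'$ satisfies the Maurer–Cartan equation $$l_1^T(T')+\frac1{2!}\,l_2^T(T',T')+\frac1{3!}\,l_3^T(T',T',T')=0 .$$ -/

import Mathlib

namespace PseudoAlg
noncomputable section
open TensorProduct PiTensorProduct WithConv

set_option linter.unusedSectionVars false
set_option linter.unusedVariables false

section Conv
variable {k H A B : Type*} [Field k] [Ring H] [HopfAlgebra k H]
  [Ring A] [Algebra k A] [Ring B] [Algebra k B]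

theorem conv_commute [Coalgebra.IsCocomm k H] (f g : H →ₗ[k] A)
    (hc : ∀ x y, Commute (f x) (g y)) : Commute (toConv f) (toConv g) := by
  change toConv f * toConv g = toConv g * toConv f
  ext x
  rw [LinearMap.convMul_apply, LinearMap.convMul_apply]
  conv_lhs => rw [← Coalgebra.comm_comul k x]
  induction (Coalgebra.comul (R := k) x) with
  | zero => simp
  | add a b ha hb => simp_all
  | tmul a b => simpa using (hc b a).eq

theorem conv_alg (f g : H →ₐ[k] A) (hc : ∀ x y, Commute (f x) (g y)) :
    (Algebra.TensorProduct.lift f g hc |>.comp (Bialgebra.comulAlgHom k H)).toLinearMap =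
      (toConv f.toLinearMap * toConv g.toLinearMap).ofConv := by
  ext x
  change Algebra.TensorProduct.lift f g hc (Coalgebra.comul x) =
    (toConv f.toLinearMap * toConv g.toLinearMap) x
  rw [LinearMap.convMul_apply]
  induction (Coalgebra.comul (R := k) x) with
  | zero => simp
  | add a b ha hb => simp_all
  | tmul a b => simp

theorem prod_ofFn_mul {r : ℕ} (a b : Fin r → A) (h : ∀ i j, i ≠ j → Commute (a i) (b j)) :
    (List.ofFn fun i => a i * b i).prod = (List.ofFn a).prod * (List.ofFn b).prod := by
  induction r with
  | zero => simp
  | succ r ih =>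
    simp only [List.ofFn_succ, List.prod_cons]
    rw [ih _ _ fun i j hij => h _ _ (by simpa using hij)]
    have : Commute (b 0) (List.ofFn fun i : Fin r => a i.succ).prod := by
      apply Commute.list_prod_right
      intro x hx
      obtain ⟨i, rfl⟩ := List.mem_ofFn.1 hx
      exact (h _ _ (Fin.succ_ne_zero i)).symm
    simp only [mul_assoc]
    rw [← mul_assoc (b 0), this.eq]
    simp only [mul_assoc]

/-- For algebra maps `φ i : H → A` with pairwise commuting images, the algebra map
`H^{⊗r} → A`, `h_1 ⊗ ⋯ ⊗ h_r ↦ φ_1(h_1) ⋯ φ_r(h_r)`. -/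
def tensorLift {r : ℕ} (φ : Fin r → H →ₐ[k] A)
    (hφ : ∀ i j, i ≠ j → ∀ x y, Commute (φ i x) (φ j y)) : (⨂[k] _ : Fin r, H) →ₐ[k] A :=
  PiTensorProduct.liftAlgHom
    ((MultilinearMap.mkPiAlgebraFin k r A).compLinearMap fun i => (φ i).toLinearMap)
    (by simp [List.ofFn_const])
    (by
      intro x y
      simpa using prod_ofFn_mul (fun i => φ i (x i)) (fun i => φ i (y i))
        fun i j hij => hφ i j hij _ _)

theorem tensorLift_tprod {r : ℕ} (φ : Fin r → H →ₐ[k] A)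
    (hφ : ∀ i j, i ≠ j → ∀ x y, Commute (φ i x) (φ j y)) (x : Fin r → H) :
    tensorLift φ hφ (tprod k x) = (List.ofFn fun i => φ i (x i)).prod := by
  simp [tensorLift]

theorem prod_ofFn_mulSingle {G : Type*} [Monoid G] {r : ℕ} (j : Fin r) (a : G) :
    (List.ofFn (Pi.mulSingle j a : Fin r → G)).prod = a := by
  induction r with
  | zero => exact j.elim0
  | succ r ih =>
    rw [List.ofFn_succ, List.prod_cons]
    refine Fin.cases ?_ (fun j => ?_) j
    · simp [Pi.mulSingle, Function.update, List.ofFn_const]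
    · rw [Pi.mulSingle_eq_of_ne (Fin.succ_ne_zero j).symm, one_mul]
      convert ih j using 3
      ext i
      simp [Pi.mulSingle, Function.update]

theorem tensorLift_single {r : ℕ} (φ : Fin r → H →ₐ[k] A)
    (hφ : ∀ i j, i ≠ j → ∀ x y, Commute (φ i x) (φ j y)) (j : Fin r) :
    (tensorLift φ hφ).comp (singleAlgHom j) = φ j := by
  ext x
  rw [AlgHom.comp_apply, singleAlgHom_apply, tensorLift_tprod]
  refine Eq.trans (congrArg List.prod (congrArg List.ofFn ?_)) (prod_ofFn_mulSingle j (φ j x))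
  ext i
  simp only [MonoidHom.mulSingle_apply]
  by_cases h : i = j
  · subst h; simp
  · simp [h]

variable [Coalgebra.IsCocomm k H]
variable {ι : Type*} (φ : ι → H →ₐ[k] A) (hφ : ∀ i j, i ≠ j → ∀ x y, Commute (φ i x) (φ j y))

/-- For algebra maps `φ i : H → A` with pairwise commuting images, the convolution product over
`i ∈ S`, that is `h ↦ ∏_{i ∈ S} φ i (h_(i))` in Sweedler notation. The order of the factors is
immaterial because `H` is cocommutative. -/
def convLin (S : Finset ι) : WithConv (H →ₗ[k] A) :=
  S.noncommProd (fun i => toConv (φ i).toLinearMap)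
    (show (S : Set ι).Pairwise (Function.onFun Commute fun i => toConv (φ i).toLinearMap) from
      fun i _ j _ hij => conv_commute _ _ (hφ i j hij))

theorem convLin_empty : convLin φ hφ ∅ = 1 := by simp [convLin]

theorem convLin_insert [DecidableEq ι] (S : Finset ι) (i : ι) (hi : i ∉ S) :
    convLin φ hφ (insert i S) = toConv (φ i).toLinearMap * convLin φ hφ S :=
  Finset.noncommProd_insert_of_notMem S i _ _ hi

theorem exists_convLin_eq (S : Finset ι) : ∃ F : H →ₐ[k] A,
    toConv F.toLinearMap = convLin φ hφ S ∧
      ∀ (z : A), (∀ i ∈ S, ∀ x, Commute z (φ i x)) → ∀ x, Commute z (F x) := by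
  classical
  induction S using Finset.induction_on with
  | empty =>
    refine ⟨(Algebra.ofId k A).comp (Bialgebra.counitAlgHom k H), ?_, ?_⟩
    · rw [convLin_empty]; rfl
    · intro z _ x
      exact (Algebra.commutes _ z).symm
  | insert i S hi ih =>
    obtain ⟨F, hF, hz⟩ := ih
    have hc : ∀ x y, Commute (φ i x) (F y) := fun x => hz _ fun j hj y =>
      hφ i j (by rintro rfl; exact hi hj) x y
    refine ⟨Algebra.TensorProduct.lift (φ i) F hc |>.comp (Bialgebra.comulAlgHom k H), ?_, ?_⟩
    · rw [conv_alg, toConv_ofConv, hF, convLin_insert _ _ _ _ hi]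
    · intro z hzz x
      change Commute z (Algebra.TensorProduct.lift (φ i) F hc (Coalgebra.comul x))
      induction (Coalgebra.comul (R := k) x) with
      | zero => simp
      | add a b ha hb => rw [map_add]; exact ha.add_right hb
      | tmul a b =>
        simp only [Algebra.TensorProduct.lift_tmul]
        exact (hzz i (by simp) a).mul_right (hz z (fun j hj => hzz j (by simp [hj])) b)

/-- The convolution product `convLin` is an algebra map, because the images commute. -/
def convProd (S : Finset ι) : H →ₐ[k] A :=
  AlgHom.ofLinearMap (convLin φ hφ S).ofConv
    (by
      obtain ⟨F, hF, -⟩ := exists_convLin_eq φ hφ S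
      rw [← hF]; exact map_one F)
    (by
      obtain ⟨F, hF, -⟩ := exists_convLin_eq φ hφ S
      rw [← hF]; exact map_mul F)

theorem toConv_convProd (S : Finset ι) :
    toConv (convProd φ hφ S).toLinearMap = convLin φ hφ S := rfl

theorem convProd_commute (S : Finset ι) (z : A) (hz : ∀ i ∈ S, ∀ x, Commute z (φ i x)) (x : H) :
    Commute z (convProd φ hφ S x) := by
  obtain ⟨F, hF, h⟩ := exists_convLin_eq φ hφ S
  have : convProd φ hφ S = F :=
    AlgHom.toLinearMap_injective (toConv_injective (by rw [toConv_convProd, hF]))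
  rw [this]; exact h z hz x

theorem convProd_singleton (i : ι) : convProd φ hφ {i} = φ i :=
  AlgHom.toLinearMap_injective (toConv_injective (by
    rw [toConv_convProd]; exact Finset.noncommProd_singleton _ _))

theorem convLin_union [DecidableEq ι] (S T : Finset ι) (h : Disjoint S T) :
    convLin φ hφ (S ∪ T) = convLin φ hφ S * convLin φ hφ T :=
  Finset.noncommProd_union_of_disjoint h _ _

/-- Algebra maps commute with convolution products. -/
theorem comp_convProd (E : A →ₐ[k] B) (ψ : ι → H →ₐ[k] B)
    (hψ : ∀ i j, i ≠ j → ∀ x y, Commute (ψ i x) (ψ j y)) (S : Finset ι)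
    (h : ∀ i ∈ S, E.comp (φ i) = ψ i) : E.comp (convProd φ hφ S) = convProd ψ hψ S := by
  classical
  apply AlgHom.toLinearMap_injective
  apply toConv_injective
  rw [toConv_convProd, AlgHom.comp_toLinearMap]
  induction S using Finset.induction_on with
  | empty =>
    rw [convLin_empty]
    ext x
    change E (convLin φ hφ ∅ x) = _
    rw [convLin_empty]
    simp
  | insert i S hi ih =>
    have h1 := ih fun j hj => h j (by simp [hj])
    rw [convLin_insert _ _ _ _ hi, ← h1, ← h i (by simp)]
    change toConv (E.toLinearMap ∘ₗ (convLin φ hφ (insert i S)).ofConv) = _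
    rw [convLin_insert _ _ _ _ hi, LinearMap.algHom_comp_convMul_distrib]
    rfl

/-- Reindexing a convolution product along an injection. -/
theorem convProd_map {κ : Type*} (e : κ ↪ ι) (S : Finset κ) :
    convProd φ hφ (S.map e) =
      convProd (fun j => φ (e j)) (fun i j hij => hφ _ _ (e.injective.ne hij)) S := by
  classical
  apply AlgHom.toLinearMap_injective
  apply toConv_injective
  rw [toConv_convProd, toConv_convProd]
  induction S using Finset.induction_on with
  | empty => simp [convLin_empty]
  | insert i S hi ih =>
    rw [Finset.map_insert, convLin_insert _ _ _ _ (by simpa using hi), convLin_insert _ _ _ _ hi, ih]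

/-- A convolution product of convolution products over the fibres of `π`. -/
theorem convProd_fiber [DecidableEq ι] [Fintype ι] {κ : Type*} [DecidableEq κ] (π : ι → κ)
    (hψ : ∀ a b : κ, a ≠ b → ∀ x y, Commute
      (convProd φ hφ (Finset.univ.filter fun i => π i = a) x)
      (convProd φ hφ (Finset.univ.filter fun i => π i = b) y)) (S : Finset κ) :
    convProd (fun j => convProd φ hφ (Finset.univ.filter (π · = j))) hψ S =
      convProd φ hφ (Finset.univ.filter (π · ∈ S)) := by
  apply AlgHom.toLinearMap_injective
  apply toConv_injective
  rw [toConv_convProd, toConv_convProd]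
  induction S using Finset.induction_on with
  | empty => simp [convLin_empty]
  | insert i S hi ih =>
    have : (Finset.univ.filter (π · ∈ insert i S)) =
        (Finset.univ.filter (π · = i)) ∪ (Finset.univ.filter (π · ∈ S)) := by
      ext; simp
    rw [convLin_insert _ _ _ _ hi, ih, this, convLin_union, toConv_convProd]
    rw [Finset.disjoint_filter]
    rintro x - rfl; exact hi

end Conv

section HT
variable {k H : Type*} [Field k] [Ring H] [HopfAlgebra k H] {ι κ : Type*} [DecidableEq ι]

theorem single_commute (i j : ι) (hij : i ≠ j) (x y : H) :
    Commute (singleAlgHom (R := k) (A := fun _ : ι => H) i x) (singleAlgHom j y) := by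
  simp only [singleAlgHom_apply]
  apply Commute.tprod
  exact Pi.mulSingle_commute (f := fun _ : ι => H) hij x y

variable [Coalgebra.IsCocomm k H]

variable (k) in
/-- The iterated coproduct of `H` spread over the tensor slots in `S`, with `1` in the other slots:
`h ↦ ∏_{i ∈ S} (1 ⊗ ⋯ ⊗ h_(i) ⊗ ⋯ ⊗ 1)`. -/
def spread (S : Finset ι) : H →ₐ[k] ⨂[k] _ : ι, H :=
  convProd (fun i => singleAlgHom (R := k) (A := fun _ : ι => H) i) single_commute S

variable (k ι) in
/-- The iterated coproduct `H → H^{⊗ι}`, `h ↦ h_(1) ⊗ ⋯ ⊗ h_(n)`. -/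
def iterComul [Fintype ι] : H →ₐ[k] ⨂[k] _ : ι, H := spread k Finset.univ

theorem spread_commute (S T : Finset ι) (h : Disjoint S T) (x y : H) :
    Commute (spread k S x) (spread k T y) := by
  refine convProd_commute _ _ _ _ (fun j hj y => ?_) y
  refine (convProd_commute _ _ _ _ (fun i hi x => ?_) x).symm
  exact single_commute j i (fun e => Finset.disjoint_left.1 h hi (e ▸ hj)) _ _

variable (k H) in
/-- For `π : ι → {1, …, r}`, the map `H^{⊗r} → H^{⊗ι}` that applies to the `j`-th factor the
iterated coproduct with values in the slots of the fibre `π⁻¹(j)`. -/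
def comulAlong [Fintype ι] {r : ℕ} (π : ι → Fin r) : (⨂[k] _ : Fin r, H) →ₐ[k] ⨂[k] _ : ι, H :=
  tensorLift (fun j => spread k (Finset.univ.filter (π · = j)))
    (fun i j hij => spread_commute _ _ (by
      rw [Finset.disjoint_filter]; rintro x - rfl; exact hij))

variable (k H) in
/-- For an injection `s : {1, …, q} → ι`, the map `H^{⊗q} → H^{⊗ι}` that puts the `a`-th factor into
the slot `s a` and `1` into the remaining slots. -/
def place {q : ℕ} (s : Fin q ↪ ι) : (⨂[k] _ : Fin q, H) →ₐ[k] ⨂[k] _ : ι, H :=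
  tensorLift (fun a => singleAlgHom (R := k) (A := fun _ : ι => H) (s a))
    (fun _ _ hij => single_commute _ _ (s.injective.ne hij))

theorem comulAlong_single [Fintype ι] {r : ℕ} (π : ι → Fin r) (j : Fin r) (h : H) :
    comulAlong k H π (singleAlgHom (R := k) (A := fun _ : Fin r => H) j h) =
      spread k (Finset.univ.filter (π · = j)) h := by
  have h1 : (comulAlong k H π).comp (singleAlgHom (R := k) (A := fun _ : Fin r => H) j) =
      spread k (Finset.univ.filter (π · = j)) := tensorLift_single _ _ j
  exact DFunLike.congr_fun h1 h

theorem place_single {q : ℕ} (s : Fin q ↪ ι) (a : Fin q) (h : H) :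
    place k H s (singleAlgHom (R := k) (A := fun _ : Fin q => H) a h) =
      singleAlgHom (R := k) (A := fun _ : ι => H) (s a) h := by
  have h1 : (place k H s).comp (singleAlgHom (R := k) (A := fun _ : Fin q => H) a) =
      singleAlgHom (R := k) (A := fun _ : ι => H) (s a) := tensorLift_single _ _ a
  exact DFunLike.congr_fun h1 h

theorem prod_ofFn_single {q : ℕ} (s : Fin q → ι) (x : Fin q → H) :
    (List.ofFn fun a => singleAlgHom (R := k) (A := fun _ : ι => H) (s a) (x a)).prod =
      PiTensorProduct.tprod k fun i =>
        (List.ofFn fun a => (Pi.mulSingle (s a) (x a) : ι → H) i).prod := by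
  have h1 : (fun a => singleAlgHom (R := k) (A := fun _ : ι => H) (s a) (x a)) =
      fun a => tprodMonoidHom k (A := fun _ : ι => H) (Pi.mulSingle (s a) (x a)) := rfl
  have h2 (v : Fin q → ι → H) :
      (List.ofFn fun a => tprodMonoidHom k (A := fun _ : ι => H) (v a)).prod =
        tprodMonoidHom k (A := fun _ : ι => H) (List.ofFn v).prod := by
    rw [map_list_prod, List.map_ofFn]; rfl
  rw [h1, h2, tprodMonoidHom_apply]
  congr 1
  ext i
  have h3 := map_list_prod (Pi.evalMonoidHom (fun _ : ι => H) i)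
    (List.ofFn fun a => (Pi.mulSingle (s a) (x a) : ι → H))
  rw [List.map_ofFn] at h3
  exact h3

theorem place_tprod {q : ℕ} (s : Fin q ↪ ι) (x : Fin q → H) :
    place k H s (PiTensorProduct.tprod k x) = PiTensorProduct.tprod k fun i =>
        (List.ofFn fun a => (Pi.mulSingle (s a) (x a) : ι → H) i).prod := by
  rw [place, tensorLift_tprod, prod_ofFn_single]

theorem comulAlong_iterComul [Fintype ι] {r : ℕ} (π : ι → Fin r) (h : H) :
    comulAlong k H π (iterComul k (Fin r) h) = iterComul k ι h := by
  have h1 : (comulAlong k H π).comp (iterComul k (Fin r)) = iterComul k ι := by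
    rw [iterComul, spread, comp_convProd (ψ := fun j => spread k (Finset.univ.filter (π · = j)))
      (hψ := fun i j hij => spread_commute _ _ (by
        rw [Finset.disjoint_filter]; rintro x - rfl; exact hij))]
    · simp only [spread]
      rw [convProd_fiber]
      simp [iterComul, spread]
    · intro j _
      exact tensorLift_single _ _ j
  exact DFunLike.congr_fun h1 h

theorem place_iterComul [Fintype ι] {q : ℕ} (s : Fin q ↪ ι) (h : H) :
    place k H s (iterComul k (Fin q) h) = spread k (Finset.univ.map s) h := by
  have h1 : (place k H s).comp (iterComul k (Fin q)) = spread k (Finset.univ.map s) := by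
    rw [iterComul, spread, comp_convProd
      (ψ := fun a => singleAlgHom (R := k) (A := fun _ : ι => H) (s a))
      (hψ := fun _ _ hij => single_commute _ _ (s.injective.ne hij)), spread, convProd_map]
    intro j _
    exact tensorLift_single _ _ j
  exact DFunLike.congr_fun h1 h

variable (k H) in
/-- For a bijection `e : ι ≃ κ`, the algebra map `H^{⊗ι} → H^{⊗κ}` that moves the factor in slot `i`
to slot `e i`. -/
def permTensor (e : ι ≃ κ) : (⨂[k] _ : ι, H) →ₐ[k] ⨂[k] _ : κ, H :=
  AlgHom.ofLinearMap (reindex k (fun _ => H) e).toLinearMap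
    (by
      change reindex k (fun _ => H) e (PiTensorProduct.tprod k 1) = PiTensorProduct.tprod k 1
      rw [reindex_tprod]; rfl)
    (by
      refine (LinearMap.map_mul_iff _).mpr ?_
      ext x y
      simp [reindex_tprod]
      rfl)

theorem permTensor_tprod (e : ι ≃ κ) (x : ι → H) :
    permTensor k H e (PiTensorProduct.tprod k x) = PiTensorProduct.tprod k fun i => x (e.symm i) :=
  reindex_tprod (s := fun _ => H) e x

theorem permTensor_iterComul [DecidableEq κ] [Fintype ι] [Fintype κ] (e : ι ≃ κ) (h : H) :
    permTensor k H e (iterComul k ι h) = iterComul k κ h := by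
  have h1 : (permTensor k H e).comp (iterComul k ι) = iterComul k κ := by
    rw [iterComul, spread, comp_convProd
      (ψ := fun a => singleAlgHom (R := k) (A := fun _ : κ => H) (e a))
      (hψ := fun _ _ hij => single_commute _ _ (e.injective.ne hij)), iterComul, spread,
      ← Finset.map_univ_equiv e, convProd_map]
    · rfl
    intro j _
    ext x
    simp only [AlgHom.comp_apply, singleAlgHom_apply, permTensor, AlgHom.ofLinearMap_apply]
    erw [reindex_tprod]
    congr 1
    funext i
    simp [Pi.mulSingle, Function.update, Equiv.symm_apply_eq]
  exact DFunLike.congr_fun h1 h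

end HT

section PseudoTensor
variable (k H ι κ M N P : Type*) [Field k] [Ring H] [HopfAlgebra k H] [Coalgebra.IsCocomm k H]
  [DecidableEq ι] [Fintype ι] [DecidableEq κ] [Fintype κ]
  [AddCommGroup M] [Module k M] [Module H M] [IsScalarTower k H M]
  [AddCommGroup N] [Module k N] [Module H N] [IsScalarTower k H N]
  [AddCommGroup P] [Module k P]

/-- The relations `F Δ(h) ⊗ m = F ⊗ h m` that define `H^{⊗ι} ⊗_H M`, where the right action of `H`
on `H^{⊗ι}` is given by the iterated coproduct `Δ`. -/
def balanced : Submodule (⨂[k] _ : ι, H) ((⨂[k] _ : ι, H) ⊗[k] M) :=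
  Submodule.span _ {z | ∃ (F : ⨂[k] _ : ι, H) (h : H) (m : M),
    z = (F * iterComul k ι h) ⊗ₜ[k] m - F ⊗ₜ[k] (h • m)}

/-- The left `H^{⊗ι}`-module `H^{⊗ι} ⊗_H M`. -/
def PseudoTensor : Type _ := ((⨂[k] _ : ι, H) ⊗[k] M) ⧸ balanced k H ι M

instance : AddCommGroup (PseudoTensor k H ι M) :=
  inferInstanceAs (AddCommGroup (((⨂[k] _ : ι, H) ⊗[k] M) ⧸ balanced k H ι M))

instance : Module (⨂[k] _ : ι, H) (PseudoTensor k H ι M) :=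
  inferInstanceAs (Module (⨂[k] _ : ι, H) (((⨂[k] _ : ι, H) ⊗[k] M) ⧸ balanced k H ι M))

instance : Module k (PseudoTensor k H ι M) :=
  inferInstanceAs (Module k (((⨂[k] _ : ι, H) ⊗[k] M) ⧸ balanced k H ι M))

instance : IsScalarTower k (⨂[k] _ : ι, H) (PseudoTensor k H ι M) :=
  inferInstanceAs (IsScalarTower k (⨂[k] _ : ι, H)
    (((⨂[k] _ : ι, H) ⊗[k] M) ⧸ balanced k H ι M))

instance : SMulCommClass k (⨂[k] _ : ι, H) (PseudoTensor k H ι M) :=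
  IsScalarTower.to_smulCommClass

namespace PseudoTensor
variable {ι κ M N P}

/-- The element `F ⊗_H m`. -/
def mk (F : ⨂[k] _ : ι, H) (m : M) : PseudoTensor k H ι M :=
  Submodule.Quotient.mk (F ⊗ₜ[k] m)

theorem smul_mk (F G : ⨂[k] _ : ι, H) (m : M) : F • mk k H G m = mk k H (F * G) m := rfl

theorem mk_mul_iterComul (F : ⨂[k] _ : ι, H) (h : H) (m : M) :
    mk k H (F * iterComul k ι h) m = mk k H F (h • m) :=
  (Submodule.Quotient.eq _).2 (Submodule.subset_span ⟨F, h, m, rfl⟩)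

variable {k H}

theorem induction_on {C : PseudoTensor k H ι M → Prop} (z : PseudoTensor k H ι M)
    (h0 : C 0) (hmk : ∀ F m, C (mk k H F m)) (hadd : ∀ a b, C a → C b → C (a + b)) : C z := by
  obtain ⟨z, rfl⟩ := Submodule.Quotient.mk_surjective _ z
  induction z with
  | zero => exact h0
  | tmul F m => exact hmk F m
  | add a b ha hb => exact hadd _ _ ha hb

/-- A `k`-bilinear map that is balanced over `H` descends to `H^{⊗ι} ⊗_H M`. -/
def lift (φ : (⨂[k] _ : ι, H) →ₗ[k] M →ₗ[k] P)
    (hφ : ∀ F h m, φ (F * iterComul k ι h) m = φ F (h • m)) : PseudoTensor k H ι M →ₗ[k] P :=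
  ((balanced k H ι M).restrictScalars k).liftQ (TensorProduct.lift φ) (by
    intro z hz
    have key : ∀ a : ⨂[k] _ : ι, H, TensorProduct.lift φ (a • z) = 0 := by
      refine Submodule.span_induction (p := fun z _ =>
        ∀ a : ⨂[k] _ : ι, H, TensorProduct.lift φ (a • z) = 0) ?_ ?_ ?_ ?_ hz
      · rintro _ ⟨F, h, m, rfl⟩ a
        rw [smul_sub, TensorProduct.smul_tmul', TensorProduct.smul_tmul', map_sub]
        simp [← hφ, mul_assoc]
      · simp
      · intro x y _ _ hx hy a
        rw [smul_add, map_add, hx, hy, add_zero]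
      · intro b x _ hx a
        rw [smul_smul, hx]
    simpa using key 1)
  ∘ₗ (Submodule.Quotient.restrictScalarsEquiv k (balanced k H ι M)).symm.toLinearMap

theorem lift_mk (φ : (⨂[k] _ : ι, H) →ₗ[k] M →ₗ[k] P)
    (hφ : ∀ F h m, φ (F * iterComul k ι h) m = φ F (h • m)) (F : ⨂[k] _ : ι, H) (m : M) :
    lift φ hφ (mk k H F m) = φ F m := rfl

variable (k H) in
theorem mk_add (F : ⨂[k] _ : ι, H) (m n : M) : mk k H F (m + n) = mk k H F m + mk k H F n := by
  rw [mk, TensorProduct.tmul_add]; rfl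

variable (k H) in
theorem mk_smul (F : ⨂[k] _ : ι, H) (c : k) (m : M) : mk k H F (c • m) = c • mk k H F m := by
  rw [mk, TensorProduct.tmul_smul]; rfl

variable (k H ι M) in
/-- The bilinear map `(F, m) ↦ F ⊗_H m`. -/
def mkBilin : (⨂[k] _ : ι, H) →ₗ[k] M →ₗ[k] PseudoTensor k H ι M :=
  LinearMap.mk₂ k (mk k H) (fun F G m => by rw [mk, TensorProduct.add_tmul]; rfl)
    (fun c F m => by rw [mk, mk, ← TensorProduct.smul_tmul']; rfl) (mk_add k H) (fun c F m => mk_smul k H F c m)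

/-- The map `id ⊗_H f` induced by an `H`-linear map `f`. -/
def map (f : M →ₗ[H] N) : PseudoTensor k H ι M →ₗ[⨂[k] _ : ι, H] PseudoTensor k H ι N :=
  (balanced k H ι M).mapQ (balanced k H ι N)
    (TensorProduct.AlgebraTensorModule.map LinearMap.id (f.restrictScalars k)) (by
      rw [balanced, Submodule.span_le]
      rintro _ ⟨F, h, m, rfl⟩
      refine Submodule.subset_span ⟨F, h, f m, ?_⟩
      simp)

theorem map_mk (f : M →ₗ[H] N) (F : ⨂[k] _ : ι, H) (m : M) :
    map f (mk k H F m) = mk k H F (f m) := rfl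

/-- The map `E ⊗_H id` induced by an algebra map `E : H^{⊗ι} → H^{⊗κ}` compatible with the iterated
coproducts. -/
def baseMap (E : (⨂[k] _ : ι, H) →ₐ[k] ⨂[k] _ : κ, H)
    (hE : ∀ h, E (iterComul k ι h) = iterComul k κ h) :
    PseudoTensor k H ι M →ₗ[k] PseudoTensor k H κ M :=
  lift (mkBilin k H κ M ∘ₗ E.toLinearMap) (by
    intro F h m
    change mk k H (E (F * iterComul k ι h)) m = mk k H (E F) (h • m)
    rw [map_mul, hE, mk_mul_iterComul])

theorem baseMap_mk (E : (⨂[k] _ : ι, H) →ₐ[k] ⨂[k] _ : κ, H)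
    (hE : ∀ h, E (iterComul k ι h) = iterComul k κ h) (F : ⨂[k] _ : ι, H) (m : M) :
    baseMap E hE (mk k H F m) = mk k H (E F) m := rfl

theorem baseMap_smul (E : (⨂[k] _ : ι, H) →ₐ[k] ⨂[k] _ : κ, H)
    (hE : ∀ h, E (iterComul k ι h) = iterComul k κ h) (F : ⨂[k] _ : ι, H)
    (z : PseudoTensor k H ι M) : baseMap E hE (F • z) = E F • baseMap E hE z := by
  induction z using induction_on with
  | h0 => simp
  | hmk G m => rw [smul_mk, baseMap_mk, baseMap_mk, smul_mk, map_mul]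
  | hadd a b ha hb => rw [smul_add, map_add, ha, hb, map_add, smul_add]

variable (k H)

/-- The map `e ⊗_H id` that permutes the factors of `H^{⊗ι}`: the factor in slot `i` moves to slot
`e i`. -/
def perm (e : ι ≃ κ) : PseudoTensor k H ι M →ₗ[k] PseudoTensor k H κ M :=
  baseMap (permTensor k H e) (permTensor_iterComul e)

/-- The map `Δ_π ⊗_H id : H^{⊗r} ⊗_H M → H^{⊗ι} ⊗_H M` given by iterated coproducts along the
fibres of `π`. -/
def expand {r : ℕ} (π : ι → Fin r) : PseudoTensor k H (Fin r) M →ₗ[k] PseudoTensor k H ι M :=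
  baseMap (comulAlong k H π) (comulAlong_iterComul π)

end PseudoTensor
end PseudoTensor

section PseudoProd
variable (k H ι : Type*) {κ : Type*} (M N L : Type*)
  [Field k] [Ring H] [HopfAlgebra k H] [Coalgebra.IsCocomm k H]
  [DecidableEq ι] [Fintype ι] [DecidableEq κ] [Fintype κ]
  [AddCommGroup M] [Module k M] [Module H M] [IsScalarTower k H M]
  [AddCommGroup N] [Module k N] [Module H N] [IsScalarTower k H N]
  [AddCommGroup L] [Module k L] [Module H L] [IsScalarTower k H L]

/-- The pseudoproducts: `H^{⊗ι}`-linear maps `M^{⊗ι} → H^{⊗ι} ⊗_H N`. -/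
def PseudoProd : Submodule k (MultilinearMap k (fun _ : ι => M) (PseudoTensor k H ι N)) where
  carrier := {f | ∀ (h : ι → H) (x : ι → M),
    f (fun i => h i • x i) = (PiTensorProduct.tprod k h : ⨂[k] _ : ι, H) • f x}
  add_mem' := by
    intro f g hf hg h x
    rw [add_apply, hf, hg, add_apply, smul_add]
  zero_mem' := by intro h x; simp
  smul_mem' := by
    intro c f hf h x
    rw [smul_apply, hf, smul_apply, smul_comm]

namespace PseudoProd
variable {k H ι M N L}

theorem map_smul_tprod (f : PseudoProd k H ι M N) (h : ι → H) (x : ι → M) :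
    f.1 (fun i => h i • x i) = (PiTensorProduct.tprod k h : ⨂[k] _ : ι, H) • f.1 x := f.2 h x

theorem map_update_smul (f : PseudoProd k H ι M N) (y : ι → M) (j : ι) (h : H) (a : M) :
    f.1 (Function.update y j (h • a)) =
      singleAlgHom (R := k) (A := fun _ : ι => H) j h • f.1 (Function.update y j a) := by
  rw [singleAlgHom_apply, ← map_smul_tprod]
  congr 1
  ext i
  by_cases hi : i = j
  · subst hi; simp
  · simp [hi]

/-- `(id ⊗_H γ) ∘ f ∘ (β ⊗ ⋯ ⊗ β)` for `H`-linear maps `β` and `γ`. -/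
def comp {N' M' : Type*} [AddCommGroup M'] [Module k M'] [Module H M'] [IsScalarTower k H M']
    [AddCommGroup N'] [Module k N'] [Module H N'] [IsScalarTower k H N']
    (γ : N →ₗ[H] N') (f : PseudoProd k H ι M N) (β : M' →ₗ[H] M) : PseudoProd k H ι M' N' :=
  ⟨((PseudoTensor.map (ι := ι) γ).restrictScalars k).compMultilinearMap
      (f.1.compLinearMap fun _ => β.restrictScalars k), by
    intro h x
    simp only [LinearMap.compMultilinearMap_apply, MultilinearMap.compLinearMap_apply,
      LinearMap.coe_restrictScalars, map_smul]
    rw [map_smul_tprod, map_smul]⟩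

/-- The action of a bijection `e : ι ≃ κ`: `(e f)(x) = (e ⊗_H id) f(x ∘ e)`. -/
def perm (e : ι ≃ κ) : PseudoProd k H ι M N →ₗ[k] PseudoProd k H κ M N where
  toFun f := ⟨(PseudoTensor.perm k H e).compMultilinearMap (f.1.domDomCongr e), by
    intro h x
    simp only [LinearMap.compMultilinearMap_apply, MultilinearMap.domDomCongr_apply]
    rw [map_smul_tprod f (fun i => h (e i)) (fun i => x (e i)), PseudoTensor.perm,
      PseudoTensor.baseMap_smul, permTensor_tprod]
    simp⟩
  map_add' f g := by ext x; simp
  map_smul' c f := by ext x; simp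

theorem perm_apply (e : ι ≃ κ) (f : PseudoProd k H ι M N) (x : κ → M) :
    (perm e f).1 x = PseudoTensor.perm k H e (f.1 fun i => x (e i)) := rfl

/-- Substitution of an element of `H^{⊗q} ⊗_H M` into the slot `j` of a pseudoproduct `f` with `r`
slots, the other slots being filled by `y`. The `r` slots are expanded to `ι` along `π : ι → Fin r`,
and `s` enumerates the fibre of `π` over `j`:
`f(y_1, …, F ⊗_H a, …, y_r) = (F ⊗ 1) (Δ_π ⊗_H id) f(y_1, …, a, …, y_r)`. -/
def subst {r q : ℕ} (f : PseudoProd k H (Fin r) M N) (π : ι → Fin r) (s : Fin q ↪ ι) (j : Fin r)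
    (hs : Finset.univ.map s = Finset.univ.filter (π · = j)) (y : Fin r → M) :
    PseudoTensor k H (Fin q) M →ₗ[k] PseudoTensor k H ι N :=
  PseudoTensor.lift
    (LinearMap.mk₂ k (fun F a => place k H s F •
        PseudoTensor.expand k H π (f.1 (Function.update y j a)))
      (by intros; simp [add_smul]) (by intros; simp)
      (by intros; simp)
      (by intro c F a; rw [f.1.map_update_smul, map_smul, smul_comm]))
    (by
      intro F h a
      simp only [LinearMap.mk₂_apply]
      rw [map_update_smul, PseudoTensor.expand, PseudoTensor.baseMap_smul, smul_smul, map_mul,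
        place_iterComul, hs]
      rw [comulAlong_single])

theorem subst_mk {r q : ℕ} (f : PseudoProd k H (Fin r) M N) (π : ι → Fin r) (s : Fin q ↪ ι)
    (j : Fin r) (hs : Finset.univ.map s = Finset.univ.filter (π · = j)) (y : Fin r → M)
    (F : ⨂[k] _ : Fin q, H) (a : M) :
    subst f π s j hs y (PseudoTensor.mk k H F a) =
      place k H s F • PseudoTensor.expand k H π (f.1 (Function.update y j a)) := rfl

theorem place_inl_tprod {m q : ℕ} (x : Fin q → H) :
    place k H (Function.Embedding.inl : Fin q ↪ Fin q ⊕ Fin m) (PiTensorProduct.tprod k x) =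
      PiTensorProduct.tprod k (Sum.elim x fun _ => 1) := by
  rw [place_tprod]
  congr 1
  ext i
  cases i with
  | inl i =>
    rw [Sum.elim_inl, ← prod_ofFn_mulSingle i (x i)]
    congr 2
    ext a
    by_cases h : a = i
    · subst h; simp
    · simp [h, Ne.symm h]
  | inr i => simp [List.ofFn_const]

theorem place_tprod_mul {m q : ℕ} (x : Fin q → H) (y : Fin m → H) :
    place k H (Function.Embedding.inl : Fin q ↪ Fin q ⊕ Fin m)
      (PiTensorProduct.tprod k x) *
      (PiTensorProduct.tprod k (Sum.elim (fun _ => 1) y)) =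
    PiTensorProduct.tprod k (Sum.elim x y) := by
  rw [place_inl_tprod, tprod_mul_tprod]
  congr 1
  ext i
  cases i <;> simp

theorem place_mul_comm {m q : ℕ} (F : ⨂[k] _ : Fin q, H) (y : Fin m → H) :
    place k H (Function.Embedding.inl : Fin q ↪ Fin q ⊕ Fin m) F *
      (PiTensorProduct.tprod k (Sum.elim (fun _ => 1) y)) =
    (PiTensorProduct.tprod k (Sum.elim (fun _ => 1) y)) *
      place k H (Function.Embedding.inl : Fin q ↪ Fin q ⊕ Fin m) F := by
  induction F using PiTensorProduct.induction_on with
  | smul_tprod c x =>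
    rw [map_smul, smul_mul_assoc, mul_smul_comm, place_tprod_mul, place_inl_tprod, tprod_mul_tprod]
    congr 2
    ext i
    cases i <;> simp
  | add a b ha hb => rw [map_add, add_mul, mul_add, ha, hb]

theorem comulAlong_cons {m q : ℕ} (y : Fin m → H) :
    comulAlong k H (Sum.elim (fun _ => 0) Fin.succ : Fin q ⊕ Fin m → Fin (m + 1))
      (PiTensorProduct.tprod k (Fin.cons 1 y)) =
    PiTensorProduct.tprod k (Sum.elim (fun _ => 1) y) := by
  rw [comulAlong, tensorLift_tprod, List.ofFn_succ, List.prod_cons, Fin.cons_zero, map_one, one_mul]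
  have h1 (b : Fin m) : (Finset.univ.filter fun i : Fin q ⊕ Fin m =>
      (Sum.elim (fun _ => 0) Fin.succ : Fin q ⊕ Fin m → Fin (m + 1)) i = b.succ) =
        {Sum.inr b} := by
    ext i; cases i <;> simp [(Fin.succ_ne_zero _).symm]
  have h2 : (fun b : Fin m => spread k (Finset.univ.filter fun i : Fin q ⊕ Fin m =>
      (Sum.elim (fun _ => 0) Fin.succ : Fin q ⊕ Fin m → Fin (m + 1)) i = b.succ)
        ((Fin.cons 1 y : Fin (m + 1) → H) b.succ)) =
      fun b => singleAlgHom (R := k) (A := fun _ : Fin q ⊕ Fin m => H) (Sum.inr b) (y b) := by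
    ext b
    rw [h1, spread, convProd_singleton, Fin.cons_succ]
  rw [h2, prod_ofFn_single]
  congr 1
  ext i
  cases i with
  | inl i => simp [List.ofFn_const]
  | inr i =>
    rw [Sum.elim_inr, ← prod_ofFn_mulSingle i (y i)]
    congr 2
    ext a
    by_cases h : a = i
    · subst h; simp
    · simp [h, Ne.symm h]

/-- The map `F ⊗_H a ↦ f(F ⊗_H a, y_1, …, y_m)` with values in `H^{⊗(q+m)} ⊗_H N`. -/
def substFirst {m q : ℕ} (f : PseudoProd k H (Fin (m + 1)) M N) (y : Fin m → M) :
    PseudoTensor k H (Fin q) M →ₗ[k] PseudoTensor k H (Fin q ⊕ Fin m) N :=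
  subst f (Sum.elim (fun _ => 0) Fin.succ) Function.Embedding.inl 0
    (by ext i; cases i <;> simp [Fin.succ_ne_zero]) (Fin.cons 0 y)

theorem substFirst_mk {m q : ℕ} (f : PseudoProd k H (Fin (m + 1)) M N) (y : Fin m → M)
    (F : ⨂[k] _ : Fin q, H) (a : M) :
    substFirst f y (PseudoTensor.mk k H F a) =
      place k H (Function.Embedding.inl : Fin q ↪ Fin q ⊕ Fin m) F •
        PseudoTensor.expand k H (Sum.elim (fun _ => 0) Fin.succ) (f.1 (Fin.cons a y)) := by
  rw [substFirst, subst_mk, Fin.update_cons_zero]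

theorem substFirst_update_add {m q : ℕ} (f : PseudoProd k H (Fin (m + 1)) M N) (y : Fin m → M)
    (b : Fin m) (u v : M) (z : PseudoTensor k H (Fin q) M) :
    substFirst f (Function.update y b (u + v)) z =
      substFirst f (Function.update y b u) z + substFirst f (Function.update y b v) z := by
  induction z using PseudoTensor.induction_on with
  | h0 => simp
  | hmk F a =>
    simp only [substFirst_mk, Fin.cons_update]
    rw [f.1.map_update_add, map_add, smul_add]
  | hadd a b ha hb => rw [map_add, ha, hb, map_add, map_add]; abel

theorem substFirst_update_smul {m q : ℕ} (f : PseudoProd k H (Fin (m + 1)) M N) (y : Fin m → M)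
    (b : Fin m) (c : k) (u : M) (z : PseudoTensor k H (Fin q) M) :
    substFirst f (Function.update y b (c • u)) z =
      c • substFirst f (Function.update y b u) z := by
  induction z using PseudoTensor.induction_on with
  | h0 => simp
  | hmk F a =>
    simp only [substFirst_mk, Fin.cons_update]
    rw [f.1.map_update_smul, map_smul, smul_comm]
  | hadd a b ha hb => rw [map_add, ha, hb, map_add, smul_add]

theorem substFirst_tprod {m q : ℕ} (f : PseudoProd k H (Fin (m + 1)) M N) (h : Fin q ⊕ Fin m → H)
    (y : Fin m → M) (z : PseudoTensor k H (Fin q) M) :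
    substFirst f (fun b => h (Sum.inr b) • y b)
        ((PiTensorProduct.tprod k fun a => h (Sum.inl a) : ⨂[k] _ : Fin q, H) • z) =
      (PiTensorProduct.tprod k h : ⨂[k] _ : Fin q ⊕ Fin m, H) • substFirst f y z := by
  induction z using PseudoTensor.induction_on with
  | h0 => simp
  | hmk F a =>
    have h1 : (Fin.cons a (fun b => h (Sum.inr b) • y b) : Fin (m + 1) → M) =
        fun i => (Fin.cons 1 (fun b => h (Sum.inr b)) : Fin (m + 1) → H) i •
          (Fin.cons a y : Fin (m + 1) → M) i := by
      ext i; refine Fin.cases ?_ (fun i => ?_) i <;> simp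
    have h2 : h = Sum.elim (fun a => h (Sum.inl a)) fun b => h (Sum.inr b) := by
      ext i; cases i <;> rfl
    rw [PseudoTensor.smul_mk, substFirst_mk, substFirst_mk, h1, map_smul_tprod,
      PseudoTensor.expand, PseudoTensor.baseMap_smul, comulAlong_cons, smul_smul, smul_smul,
      map_mul, mul_assoc, place_mul_comm, ← mul_assoc, place_tprod_mul, ← h2]
  | hadd a b ha hb => rw [smul_add, map_add, ha, hb, map_add, smul_add]

/-- `(x_1, …, x_q, y_1, …, y_m) ↦ f(g(x_1, …, x_q), y_1, …, y_m)`. -/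
def compFirst {m q : ℕ} (f : PseudoProd k H (Fin (m + 1)) M N) (g : PseudoProd k H (Fin q) M M) :
    PseudoProd k H (Fin q ⊕ Fin m) M N :=
  ⟨{ toFun := fun x => substFirst f (fun b => x (Sum.inr b)) (g.1 fun a => x (Sum.inl a))
     map_update_add' := by
      intro inst x i u v
      obtain rfl : inst = instDecidableEqSum := Subsingleton.elim _ _
      cases i with
      | inl i =>
        have e (w : M) : (fun a => Function.update x (Sum.inl i) w (Sum.inl a)) =
            Function.update (fun a => x (Sum.inl a)) i w := Sum.update_inl_comp_inl
        simp only [e, g.1.map_update_add, map_add, Function.update_of_ne, ne_eq, reduceCtorEq,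
          not_false_eq_true]
      | inr i =>
        have e (w : M) : (fun a => Function.update x (Sum.inr i) w (Sum.inr a)) =
            Function.update (fun a => x (Sum.inr a)) i w := Sum.update_inr_comp_inr
        simp only [e, substFirst_update_add, Function.update_of_ne, ne_eq, reduceCtorEq,
          not_false_eq_true]
     map_update_smul' := by
      intro inst x i c u
      obtain rfl : inst = instDecidableEqSum := Subsingleton.elim _ _
      cases i with
      | inl i =>
        have e (w : M) : (fun a => Function.update x (Sum.inl i) w (Sum.inl a)) =
            Function.update (fun a => x (Sum.inl a)) i w := Sum.update_inl_comp_inl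
        simp only [e, g.1.map_update_smul, map_smul, Function.update_of_ne, ne_eq, reduceCtorEq,
          not_false_eq_true]
      | inr i =>
        have e (w : M) : (fun a => Function.update x (Sum.inr i) w (Sum.inr a)) =
            Function.update (fun a => x (Sum.inr a)) i w := Sum.update_inr_comp_inr
        simp only [e, substFirst_update_smul, Function.update_of_ne, ne_eq, reduceCtorEq,
          not_false_eq_true] }, by
    intro h x
    simp only [MultilinearMap.coe_mk]
    rw [map_smul_tprod g (fun a => h (Sum.inl a)) (fun a => x (Sum.inl a)), substFirst_tprod]⟩

end PseudoProd
end PseudoProd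

section Bracket
variable {k H ι M N : Type*}
  [Field k] [Ring H] [HopfAlgebra k H] [Coalgebra.IsCocomm k H] [DecidableEq ι] [Fintype ι]
  [AddCommGroup M] [Module k M] [Module H M] [IsScalarTower k H M]
  [AddCommGroup N] [Module k N] [Module H N] [IsScalarTower k H N]

/-- Skew-symmetry: `f(x_1, …, x_p) = (-1)^σ (σ ⊗_H id) f(x_σ(1), …, x_σ(p))` for all `σ`. -/
def IsSkew (f : PseudoProd k H ι M N) : Prop :=
  ∀ σ : Equiv.Perm ι, f = (Equiv.Perm.sign σ : ℤ) • PseudoProd.perm σ f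

/-- `C^p(M, N)`, the skew-symmetric pseudoproducts with `p` arguments. -/
def Cochain (k H : Type*) (p : ℕ) (M N : Type*)
    [Field k] [Ring H] [HopfAlgebra k H] [Coalgebra.IsCocomm k H]
    [AddCommGroup M] [Module k M] [Module H M] [IsScalarTower k H M]
    [AddCommGroup N] [Module k N] [Module H N] [IsScalarTower k H N] :
    Submodule k (PseudoProd k H (Fin p) M N) where
  carrier := {f | IsSkew f}
  add_mem' := by
    intro f g hf hg σ
    rw [map_add, smul_add, ← hf σ, ← hg σ]
  zero_mem' := by intro σ; simp
  smul_mem' := by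
    intro c f hf σ
    rw [map_smul, smul_comm, ← hf σ]

/-- `σ` is a `(q, m)`-shuffle: a permutation of `q + m` letters that is increasing on the first `q`
and on the last `m` of them. -/
def IsShuffle (q m : ℕ) {n : ℕ} (σ : Equiv.Perm (Fin n)) : Prop :=
  ∀ i j : Fin n, i < j → (j.val < q ∨ q ≤ i.val) → σ i < σ j

instance (q m : ℕ) {n : ℕ} : DecidablePred (IsShuffle q m (n := n)) := fun σ =>
  inferInstanceAs (Decidable (∀ i j : Fin n, i < j → (j.val < q ∨ q ≤ i.val) → σ i < σ j))

/-- The identification of the letters `1, …, q` and `q + 1, …, q + m` with `1, …, n`, followed by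
the permutation `σ`. -/
def splitPerm {q m n : ℕ} (h : q + m = n) (σ : Equiv.Perm (Fin n)) : Fin q ⊕ Fin m ≃ Fin n :=
  (finSumFinEquiv.trans (finCongr h)).trans σ

/-- The circle product of `f` with `m + 1` arguments and `g` with `q` arguments:
`∑_σ (-1)^σ (σ ⊗_H id) f(g(x_σ(1), …, x_σ(q)), x_σ(q+1), …, x_σ(q+m))`
over the `(q, m)`-shuffles `σ`. -/
def circ {m q n : ℕ} (h : q + m = n) (f : PseudoProd k H (Fin (m + 1)) M M)
    (g : PseudoProd k H (Fin q) M M) : PseudoProd k H (Fin n) M M :=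
  ∑ σ ∈ Finset.univ.filter (fun σ : Equiv.Perm (Fin n) => IsShuffle q m σ),
    (Equiv.Perm.sign σ : ℤ) • PseudoProd.perm (splitPerm h σ) (PseudoProd.compFirst f g)

/-- The Nijenhuis-Richardson bracket
`[f, g] = f ⊚ g - (-1)^{(p-1)(q-1)} g ⊚ f`, `p = m + 1`, `q = n + 1`, given by its formula on all
pseudoproducts of `M`. -/
def nr {m n : ℕ} (f : PseudoProd k H (Fin (m + 1)) M M) (g : PseudoProd k H (Fin (n + 1)) M M) :
    PseudoProd k H (Fin (m + n + 1)) M M :=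
  circ (by omega) f g - (-1 : ℤ) ^ (m * n) • circ (by omega) g f

end Bracket

section LiePseudoalgebra
variable (k H L : Type*) [Field k] [Ring H] [HopfAlgebra k H] [Coalgebra.IsCocomm k H]
  [AddCommGroup L] [Module k L] [Module H L] [IsScalarTower k H L]

variable {k H L} in
/-- `f(f(a, b), c)` in `H^{⊗3} ⊗_H L`. -/
def nestLeft (f : PseudoProd k H (Fin 2) L L) (a b c : L) : PseudoTensor k H (Fin 3) L :=
  PseudoProd.subst f ![0, 0, 1] Fin.castSuccEmb 0 (by decide) ![0, c] (f.1 ![a, b])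

variable {k H L} in
/-- `f(a, f(b, c))` in `H^{⊗3} ⊗_H L`. -/
def nestRight (f : PseudoProd k H (Fin 2) L L) (a b c : L) : PseudoTensor k H (Fin 3) L :=
  PseudoProd.subst f ![0, 1, 1] (Fin.succEmb 2) 1 (by decide) ![a, 0] (f.1 ![b, c])

/-- A Lie `H`-pseudoalgebra structure on the `H`-module `L`: a skew-symmetric pseudobracket with
`[a * [b * c]] - [[a * b] * c] - ((12) ⊗_H id) [b * [a * c]] = 0` in `H^{⊗3} ⊗_H L`. -/
structure LiePseudoalgebra where
  bracket : PseudoProd k H (Fin 2) L L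
  skew : IsSkew bracket
  jacobi : ∀ a b c : L,
    nestRight bracket a b c - nestLeft bracket a b c -
      PseudoTensor.perm k H (Equiv.swap (0 : Fin 3) 1) (nestRight bracket b a c) = 0

end LiePseudoalgebra

section PseudoBilin
variable (k H A B C : Type*) {L : Type*} [Field k] [Ring H] [HopfAlgebra k H]
  [Coalgebra.IsCocomm k H]
  [AddCommGroup A] [Module k A] [Module H A] [IsScalarTower k H A]
  [AddCommGroup B] [Module k B] [Module H B] [IsScalarTower k H B]
  [AddCommGroup C] [Module k C] [Module H C] [IsScalarTower k H C]
  [AddCommGroup L] [Module k L] [Module H L] [IsScalarTower k H L]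

/-- `H^{⊗2}`-linear maps `A ⊗ B → H^{⊗2} ⊗_H C`. -/
def PseudoBilin : Submodule k (A →ₗ[k] B →ₗ[k] PseudoTensor k H (Fin 2) C) where
  carrier := {f | ∀ (h₁ h₂ : H) (a : A) (b : B),
    f (h₁ • a) (h₂ • b) =
      (PiTensorProduct.tprod k ![h₁, h₂] : ⨂[k] _ : Fin 2, H) • f a b}
  add_mem' := by
    intro f g hf hg h₁ h₂ a b
    simp only [LinearMap.add_apply]
    rw [hf, hg, smul_add]
  zero_mem' := by intro h₁ h₂ a b; simp
  smul_mem' := by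
    intro c f hf h₁ h₂ a b
    simp only [LinearMap.smul_apply]
    rw [hf, smul_comm]

variable {k H A B C}

theorem PseudoProd.pair_add_left (f : PseudoProd k H (Fin 2) L B) (a a' b : L) :
    f.1 ![a + a', b] = f.1 ![a, b] + f.1 ![a', b] := f.1.cons_add ![b] a a'

theorem PseudoProd.pair_smul_left (f : PseudoProd k H (Fin 2) L B) (c : k) (a b : L) :
    f.1 ![c • a, b] = c • f.1 ![a, b] := f.1.cons_smul ![b] c a

theorem PseudoProd.pair_add_right (f : PseudoProd k H (Fin 2) L B) (a b b' : L) :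
    f.1 ![a, b + b'] = f.1 ![a, b] + f.1 ![a, b'] := by
  have e (c : L) : Function.update ![a, b] 1 c = ![a, c] := by
    ext i; fin_cases i <;> simp
  rw [← e, f.1.map_update_add, e, e]

theorem PseudoProd.pair_smul_right (f : PseudoProd k H (Fin 2) L B) (c : k) (a b : L) :
    f.1 ![a, c • b] = c • f.1 ![a, b] := by
  have e (d : L) : Function.update ![a, b] 1 d = ![a, d] := by
    ext i; fin_cases i <;> simp
  rw [← e, f.1.map_update_smul, e]

/-- The map `(a, b) ↦ (id ⊗_H γ) f(α a, β b)`. -/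
def PseudoProd.component (f : PseudoProd k H (Fin 2) L L) (α : A →ₗ[H] L) (β : B →ₗ[H] L)
    (γ : L →ₗ[H] C) : PseudoBilin k H A B C :=
  ⟨LinearMap.mk₂ k (fun a b => PseudoTensor.map γ (f.1 ![α a, β b]))
    (by intro a a' b; rw [map_add, PseudoProd.pair_add_left, map_add])
    (by
      intro c a b
      rw [LinearMap.map_smul_of_tower α, PseudoProd.pair_smul_left, LinearMap.map_smul_of_tower])
    (by intro a b b'; rw [map_add, PseudoProd.pair_add_right, map_add])
    (by
      intro c a b
      rw [LinearMap.map_smul_of_tower β, PseudoProd.pair_smul_right,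
        LinearMap.map_smul_of_tower]), by
    intro h₁ h₂ a b
    simp only [LinearMap.mk₂_apply]
    rw [← map_smul, ← PseudoProd.map_smul_tprod]
    congr 2
    ext i
    fin_cases i <;> simp⟩

/-- The map `(x_1, x_2) ↦ (id ⊗_H γ) κ(α x_1, β x_2)`. -/
def PseudoBilin.pull (κ : PseudoBilin k H A B C) (α : L →ₗ[H] A) (β : L →ₗ[H] B)
    (γ : C →ₗ[H] L) : PseudoProd k H (Fin 2) L L :=
  ⟨{ toFun := fun x => PseudoTensor.map γ (κ.1 (α (x 0)) (β (x 1)))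
     map_update_add' := by
      intro inst x i u v
      obtain rfl : inst = instDecidableEqFin 2 := Subsingleton.elim _ _
      fin_cases i <;> simp
     map_update_smul' := by
      intro inst x i c u
      obtain rfl : inst = instDecidableEqFin 2 := Subsingleton.elim _ _
      fin_cases i <;> simp [LinearMap.map_smul_of_tower] }, by
    intro h x
    simp only [MultilinearMap.coe_mk, map_smul]
    rw [κ.2, map_smul]
    congr 3
    ext i
    fin_cases i <;> simp⟩

end PseudoBilin

section QuasiTwilled
variable (k H g h : Type*) [Field k] [Ring H] [HopfAlgebra k H] [Coalgebra.IsCocomm k H]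
  [AddCommGroup g] [Module k g] [Module H g] [IsScalarTower k H g]
  [AddCommGroup h] [Module k h] [Module H h] [IsScalarTower k H h]

/-- A quasi-twilled Lie pseudoalgebra `(g ⊞ h, g, h)`: a Lie pseudoalgebra structure on the
`H`-module `g ⊞ h` for which `h` is a subpseudoalgebra, i.e. the pseudobracket of two elements of
`h` lies in `H^{⊗2} ⊗_H h`. -/
structure QuasiTwilled extends LiePseudoalgebra k H (g × h) where
  closed : ∀ u v : h, bracket.1 ![(0, u), (0, v)] ∈
    LinearMap.range (PseudoTensor.map (k := k) (ι := Fin 2) (LinearMap.inr H g h))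

variable {k H g h}

/-- An `H`-linear map `T : h → g` viewed as the element
`u ↦ 1 ⊗_H T u` of `C^1(h, g)`. -/
def ofHom (T : h →ₗ[H] g) : Cochain k H 1 h g :=
  ⟨⟨{ toFun := fun x => PseudoTensor.mk k H 1 (T (x 0))
      map_update_add' := by
        intro inst x i u v
        obtain rfl := Subsingleton.elim i 0
        simp [PseudoTensor.mk_add]
      map_update_smul' := by
        intro inst x i c u
        obtain rfl := Subsingleton.elim i 0
        simp [LinearMap.map_smul_of_tower, PseudoTensor.mk_smul] }, by
      intro h x
      have h1 : (PiTensorProduct.tprod k h : ⨂[k] _ : Fin 1, H) = iterComul k (Fin 1) (h 0) := by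
        rw [iterComul, spread, Finset.univ_unique, convProd_singleton, singleAlgHom_apply]
        congr 1
        ext i
        obtain rfl := Subsingleton.elim i 0
        simp
      simp only [MultilinearMap.coe_mk, map_smul]
      rw [h1, ← PseudoTensor.mk_mul_iterComul, one_mul, PseudoTensor.smul_mk, mul_one]⟩, by
    intro σ
    obtain rfl := Subsingleton.elim σ 1
    rw [Equiv.Perm.sign_one, Units.val_one, one_smul]
    ext x
    change _ = PseudoTensor.mk k H (permTensor k H (1 : Equiv.Perm (Fin 1)) 1) (T (x 0))
    rw [map_one]
    rfl⟩

/-- The lift of a cochain in `C^p(h, g)` to a pseudoproduct on `g ⊞ h`: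
`((x_1, u_1), …, (x_p, u_p)) ↦ (f(u_1, …, u_p), 0)`. -/
def hat {p : ℕ} (f : Cochain k H p h g) : PseudoProd k H (Fin p) (g × h) (g × h) :=
  PseudoProd.comp (LinearMap.inl H g h) f.1 (LinearMap.snd H g h)

namespace QuasiTwilled
variable (Q : QuasiTwilled k H g h)

/-- The component `g ⊗ g → H^{⊗2} ⊗_H g` of the pseudobracket. -/
def pi : PseudoBilin k H g g g :=
  PseudoProd.component Q.bracket (LinearMap.inl H g h) (LinearMap.inl H g h) (LinearMap.fst H g h)

/-- The component `g ⊗ g → H^{⊗2} ⊗_H h` of the pseudobracket. -/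
def theta : PseudoBilin k H g g h :=
  PseudoProd.component Q.bracket (LinearMap.inl H g h) (LinearMap.inl H g h) (LinearMap.snd H g h)

/-- The component `g ⊗ h → H^{⊗2} ⊗_H g` of the pseudobracket. -/
def eta : PseudoBilin k H g h g :=
  PseudoProd.component Q.bracket (LinearMap.inl H g h) (LinearMap.inr H g h) (LinearMap.fst H g h)

/-- The component `g ⊗ h → H^{⊗2} ⊗_H h` of the pseudobracket. -/
def rho : PseudoBilin k H g h h :=
  PseudoProd.component Q.bracket (LinearMap.inl H g h) (LinearMap.inr H g h) (LinearMap.snd H g h)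

/-- The component `h ⊗ h → H^{⊗2} ⊗_H h`, the pseudobracket of `h`. -/
def mu : PseudoBilin k H h h h :=
  PseudoProd.component Q.bracket (LinearMap.inr H g h) (LinearMap.inr H g h) (LinearMap.snd H g h)

/-- `T : h → g` is a deformation map of type II. -/
def IsDMap (T : h →ₗ[H] g) : Prop :=
  ∀ u v : h,
    Q.pi.1 (T u) (T v) + Q.eta.1 (T u) v -
        PseudoTensor.perm k H (Equiv.swap (0 : Fin 2) 1) (Q.eta.1 (T v) u) =
      PseudoTensor.map T (Q.rho.1 (T u) v -
        PseudoTensor.perm k H (Equiv.swap (0 : Fin 2) 1) (Q.rho.1 (T v) u) +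
        Q.mu.1 u v + Q.theta.1 (T u) (T v))

/-- The lift of `pi`: `((x, u), (y, v)) ↦ (pi(x, y), 0)`. -/
def piHat : PseudoProd k H (Fin (1 + 1)) (g × h) (g × h) :=
  PseudoBilin.pull Q.pi (LinearMap.fst H g h) (LinearMap.fst H g h) (LinearMap.inl H g h)

/-- The lift of `theta`: `((x, u), (y, v)) ↦ (0, theta(x, y))`. -/
def thetaHat : PseudoProd k H (Fin (1 + 1)) (g × h) (g × h) :=
  PseudoBilin.pull Q.theta (LinearMap.fst H g h) (LinearMap.fst H g h) (LinearMap.inr H g h)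

/-- The lift of `mu`: `((x, u), (y, v)) ↦ (0, mu(u, v))`. -/
def muHat : PseudoProd k H (Fin (1 + 1)) (g × h) (g × h) :=
  PseudoBilin.pull Q.mu (LinearMap.snd H g h) (LinearMap.snd H g h) (LinearMap.inr H g h)

/-- The lift of `eta`: `((x, u), (y, v)) ↦ (eta(x, v) - ((12) ⊗_H id) eta(y, u), 0)`. -/
def etaHat : PseudoProd k H (Fin (1 + 1)) (g × h) (g × h) :=
  PseudoBilin.pull Q.eta (LinearMap.fst H g h) (LinearMap.snd H g h) (LinearMap.inl H g h) -
    PseudoProd.perm (Equiv.swap (0 : Fin 2) 1)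
      (PseudoBilin.pull Q.eta (LinearMap.fst H g h) (LinearMap.snd H g h) (LinearMap.inl H g h))

/-- The lift of `rho`: `((x, u), (y, v)) ↦ (0, rho(x, v) - ((12) ⊗_H id) rho(y, u))`. -/
def rhoHat : PseudoProd k H (Fin (1 + 1)) (g × h) (g × h) :=
  PseudoBilin.pull Q.rho (LinearMap.fst H g h) (LinearMap.snd H g h) (LinearMap.inr H g h) -
    PseudoProd.perm (Equiv.swap (0 : Fin 2) 1)
      (PseudoBilin.pull Q.rho (LinearMap.fst H g h) (LinearMap.snd H g h) (LinearMap.inr H g h))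

variable {m n r : ℕ}

/-- `l_1(f) = [μ + η, f]`, where `f ∈ C^p(h, g)`, `μ` and `η` are identified with their lifts to
pseudoproducts on `g ⊞ h`. The same identification is made in the other operations. -/
def l1 (f : Cochain k H (m + 1) h g) : PseudoProd k H (Fin (1 + m + 1)) (g × h) (g × h) :=
  nr (Q.muHat + Q.etaHat) (hat f)

/-- `l_2(f_1, f_2) = [[π + ρ, f_1], f_2]`. -/
def l2 (f₁ : Cochain k H (m + 1) h g) (f₂ : Cochain k H (n + 1) h g) :
    PseudoProd k H (Fin (1 + m + n + 1)) (g × h) (g × h) :=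
  nr (nr (Q.piHat + Q.rhoHat) (hat f₁)) (hat f₂)

/-- `l_3(f_1, f_2, f_3) = [[[θ, f_1], f_2], f_3]`. -/
def l3 (f₁ : Cochain k H (m + 1) h g) (f₂ : Cochain k H (n + 1) h g)
    (f₃ : Cochain k H (r + 1) h g) :
    PseudoProd k H (Fin (1 + m + n + r + 1)) (g × h) (g × h) :=
  nr (nr (nr Q.thetaHat (hat f₁)) (hat f₂)) (hat f₃)

/-- `l_1^T(f) = l_1(f) + l_2(T, f) + 1/2 l_3(T, T, f)`. -/
def l1T (T : Cochain k H 1 h g) (f : Cochain k H (m + 1) h g) :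
    PseudoProd k H (Fin (1 + m + 1)) (g × h) (g × h) :=
  Q.l1 f + Q.l2 T f + (1 / 2 : k) • Q.l3 T T f

/-- `l_2^T(f_1, f_2) = l_2(f_1, f_2) + l_3(T, f_1, f_2)`. -/
def l2T (T : Cochain k H 1 h g) (f₁ : Cochain k H (m + 1) h g)
    (f₂ : Cochain k H (n + 1) h g) :
    PseudoProd k H (Fin (1 + m + n + 1)) (g × h) (g × h) :=
  Q.l2 f₁ f₂ + Q.l3 T f₁ f₂

/-- `l_3^T(f_1, f_2, f_3) = l_3(f_1, f_2, f_3)`. -/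
def l3T (T : Cochain k H 1 h g) (f₁ : Cochain k H (m + 1) h g)
    (f₂ : Cochain k H (n + 1) h g) (f₃ : Cochain k H (r + 1) h g) :
    PseudoProd k H (Fin (1 + m + n + r + 1)) (g × h) (g × h) :=
  Q.l3 f₁ f₂ f₃

/-- The Maurer-Cartan equation
`l_1^T(f) + 1/2! l_2^T(f, f) + 1/3! l_3^T(f, f, f) = 0` for an element `f` of degree `0`. -/
def IsTwistedMC (T f : Cochain k H 1 h g) : Prop :=
  Q.l1T T f + (1 / (Nat.factorial 2 : k)) • Q.l2T T f f +
    (1 / (Nat.factorial 3 : k)) • Q.l3T T f f f = 0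

end QuasiTwilled
end QuasiTwilled

end
end PseudoAlg

/-! The deformation equation is polynomial of degree three in the map. For H-linear S : h → g let
D(S) be the left side of the equation minus its right side. Then D(S) = l_1(S) + (1/2) l_2(S,S) +
(1/6) l_3(S,S,S), up to the inclusion of g in g ⊞ h. The operations l_2 and l_3 are symmetric on
maps h → g, so expanding D(T + T') around T gives D(T + T') = D(T) + l_1^T(T') + (1/2) l_2^T(T',T')
+ (1/6) l_3^T(T',T',T'). Since D(T) = 0, the Maurer–Cartan equation for T' says exactly that D(T +
T') = 0.

To make this explicit, the brackets must be evaluated. Bracketing a skew-symmetric binary f with an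
H-linear endomorphism E needs no proper coproduct and gives f(Ea, b) + f(a, Eb) - E f(a, b)
(`nr_unary_pair`). The result is again skew-symmetric (`PairSkew.nr_unary`), so the formula
iterates.

Lifts of maps h → g land in g and vanish on g, so any composite of two of them is zero. This removes
most terms of the iterated brackets. What survives is listed in `l1_ofHom_apply`, `l2_ofHom_apply`
and `l3_ofHom_apply`; it depends only on the h-components of the arguments and has values in g. The
expansion itself is `twisted_apply`. -/

namespace PseudoAlg
noncomputable section
open TensorProduct PiTensorProduct

/-! ### Tensor factors of H under bijections of slots -/

section Slots
variable {k H ι : Type*} [Field k] [Ring H] [HopfAlgebra k H] [Coalgebra.IsCocomm k H]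
  [DecidableEq ι]

/-- Only the factor with index `e i` differs from 1 in slot `i`. This reads off, slot by slot, a
product of tensors each supported in one slot. -/
theorem prod_ofFn_mulSingle_equiv {r : ℕ} (e : ι ≃ Fin r) (x : Fin r → H) (i : ι) :
    (List.ofFn fun a => (Pi.mulSingle (e.symm a) (x a) : ι → H) i).prod = x (e i) := by
  rw [← prod_ofFn_mulSingle (e i) (x (e i))]
  congr 2
  ext a
  by_cases h : a = e i
  · subst h; simp
  · rw [Pi.mulSingle_eq_of_ne h, Pi.mulSingle_eq_of_ne]
    rintro rfl
    simp at h

/-- Expanding along a bijection is a permutation of the tensor factors. -/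
theorem comulAlong_equiv [Fintype ι] {r : ℕ} (e : ι ≃ Fin r) (F : ⨂[k] _ : Fin r, H) :
    comulAlong k H e F = permTensor k H e.symm F := by
  induction F using PiTensorProduct.induction_on with
  | smul_tprod c x =>
    -- Fibres of a bijection are single slots, so every iterated coproduct in `comulAlong` is the
    -- identity of H.
    have h1 (j : Fin r) : Finset.univ.filter (fun i => e i = j) = {e.symm j} := by
      ext i; simp [Equiv.eq_symm_apply]
    rw [map_smul, map_smul, permTensor_tprod, comulAlong, tensorLift_tprod]
    simp only [h1, spread, convProd_singleton]
    rw [prod_ofFn_single]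
    simp only [prod_ofFn_mulSingle_equiv, Equiv.symm_symm]
  | add a b ha hb => rw [map_add, map_add, ha, hb]

theorem permTensor_trans {κ ν : Type*} [DecidableEq κ] (e : ι ≃ κ) (e' : κ ≃ ν) (F : ⨂[k] _ : ι, H) :
    permTensor k H e' (permTensor k H e F) = permTensor k H (e.trans e') F := by
  induction F using PiTensorProduct.induction_on with
  | smul_tprod c x => simp only [map_smul, permTensor_tprod]; rfl
  | add a b ha hb => simp only [map_add, ha, hb]

theorem permTensor_refl (F : ⨂[k] _ : ι, H) : permTensor k H (Equiv.refl ι) F = F := by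
  induction F using PiTensorProduct.induction_on with
  | smul_tprod c x => simp only [map_smul, permTensor_tprod]; rfl
  | add a b ha hb => simp only [map_add, ha, hb]

end Slots

/-! ### Functoriality of pseudotensors in the slots and in the module -/

section Perm
variable {k H ι κ ν M N P : Type*} [Field k] [Ring H] [HopfAlgebra k H] [Coalgebra.IsCocomm k H]
  [DecidableEq ι] [Fintype ι] [DecidableEq κ] [Fintype κ] [DecidableEq ν] [Fintype ν]
  [AddCommGroup M] [Module k M] [Module H M] [IsScalarTower k H M]
  [AddCommGroup N] [Module k N] [Module H N] [IsScalarTower k H N]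
  [AddCommGroup P] [Module k P] [Module H P] [IsScalarTower k H P]

namespace PseudoTensor

theorem perm_trans (e : ι ≃ κ) (e' : κ ≃ ν) (z : PseudoTensor k H ι M) :
    perm k H e' (perm k H e z) = perm k H (e.trans e') z := by
  induction z using induction_on with
  | h0 => simp
  | hmk F m => simp only [perm, baseMap_mk, permTensor_trans]
  | hadd a b ha hb => simp only [map_add, ha, hb]

theorem perm_refl (z : PseudoTensor k H ι M) : perm k H (Equiv.refl ι) z = z := by
  induction z using induction_on with
  | h0 => simp
  | hmk F m => simp only [perm, baseMap_mk, permTensor_refl]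
  | hadd a b ha hb => simp only [map_add, ha, hb]

theorem perm_swap_swap (i j : ι) (z : PseudoTensor k H ι M) :
    perm k H (Equiv.swap i j) (perm k H (Equiv.swap i j) z) = z := by
  rw [perm_trans, Equiv.swap_swap, perm_refl]

/-- Substituting the value of a one-argument map replaces a slot by a single slot; this lemma turns
the resulting expansion into a mere relabelling. -/
theorem expand_equiv {r : ℕ} (e : ι ≃ Fin r) (z : PseudoTensor k H (Fin r) M) :
    expand k H e z = perm k H e.symm z := by
  induction z using induction_on with
  | h0 => simp
  | hmk F m => simp only [perm, expand, baseMap_mk, comulAlong_equiv]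
  | hadd a b ha hb => simp only [map_add, ha, hb]

theorem map_perm (f : M →ₗ[H] N) (e : ι ≃ κ) (z : PseudoTensor k H ι M) :
    map f (perm k H e z) = perm k H e (map f z) := by
  induction z using induction_on with
  | h0 => simp
  | hmk F m => rfl
  | hadd a b ha hb => simp only [map_add, ha, hb]

theorem map_map (f : N →ₗ[H] P) (f' : M →ₗ[H] N) (z : PseudoTensor k H ι M) :
    map f (map f' z) = map (f ∘ₗ f') z := by
  induction z using induction_on with
  | h0 => simp
  | hmk F m => rfl
  | hadd a b ha hb => simp only [map_add, ha, hb]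

theorem map_id (z : PseudoTensor k H ι M) : map (LinearMap.id : M →ₗ[H] M) z = z := by
  induction z using induction_on with
  | h0 => simp
  | hmk F m => rfl
  | hadd a b ha hb => simp only [map_add, ha, hb]

theorem map_zero_left (z : PseudoTensor k H ι M) : map (0 : M →ₗ[H] N) z = 0 := by
  induction z using induction_on with
  | h0 => simp
  | hmk F m => exact (mkBilin k H ι N F).map_zero
  | hadd a b ha hb => simp only [map_add, ha, hb, add_zero]

theorem map_add_left (f f' : M →ₗ[H] N) (z : PseudoTensor k H ι M) :
    map (f + f') z = map f z + map f' z := by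
  induction z using induction_on with
  | h0 => simp
  | hmk F m => exact mk_add k H F (f m) (f' m)
  | hadd a b ha hb => simp only [map_add, ha, hb]; abel

end PseudoTensor
end Perm

/-! ### Brackets of binary pseudoproducts with H-linear maps -/

section Unary
variable {k H M : Type*} [Field k] [Ring H] [HopfAlgebra k H] [Coalgebra.IsCocomm k H]
  [AddCommGroup M] [Module k M] [Module H M] [IsScalarTower k H M]

theorem filter_isShuffle_one_one :
    Finset.univ.filter (fun σ : Equiv.Perm (Fin 2) => IsShuffle 1 1 σ) =
      {1, Equiv.swap 0 1} := by decide

theorem filter_isShuffle_two_zero :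
    Finset.univ.filter (fun σ : Equiv.Perm (Fin 2) => IsShuffle 2 0 σ) = {1} := by decide

/-- The inserted pseudotensor is 1 ⊗_H E(x), so its coefficient acts trivially, and the slot map of
the substitution is a bijection. Only the permutation of the shuffle remains. -/
theorem perm_compFirst_unary {E : M →ₗ[H] M} {t : PseudoProd k H (Fin (0 + 1)) M M}
    (ht : ∀ x, t.1 x = PseudoTensor.mk k H 1 (E (x 0)))
    (f : PseudoProd k H (Fin (1 + 1)) M M) (σ : Equiv.Perm (Fin 2)) (x : Fin 2 → M) :
    (PseudoProd.perm (splitPerm (q := 0 + 1) (m := 1) rfl σ) (PseudoProd.compFirst f t)).1 x =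
      PseudoTensor.perm k H σ (f.1 ![E (x (σ 0)), x (σ 1)]) := by
  let e : Fin 1 ⊕ Fin 1 ≃ Fin (1 + 1) := finSumFinEquiv
  have he : (Sum.elim (fun _ => 0) Fin.succ : Fin 1 ⊕ Fin 1 → Fin (1 + 1)) = e := by decide
  rw [PseudoProd.perm_apply]
  change PseudoTensor.perm k H _ (PseudoProd.substFirst f _ (t.1 _)) = _
  rw [ht, PseudoProd.substFirst_mk, map_one, one_smul, he, PseudoTensor.expand_equiv,
    PseudoTensor.perm_trans]
  -- The relabelling produced by the expansion is inverse to the identification of letters built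
  -- into `splitPerm`.
  have h1 : e.symm.trans (splitPerm (q := 0 + 1) (m := 1) rfl σ) = σ := by
    ext i; fin_cases i <;> rfl
  rw [h1]
  congr 2
  ext i
  fin_cases i <;> rfl

/-- In t(F ⊗_H a) the coproduct is applied to the coefficient 1 of 1 ⊗_H E(a), hence gives 1; the
value is F ⊗_H E(a). -/
theorem perm_unary_compFirst {E : M →ₗ[H] M} {t : PseudoProd k H (Fin (0 + 1)) M M}
    (ht : ∀ x, t.1 x = PseudoTensor.mk k H 1 (E (x 0)))
    (f : PseudoProd k H (Fin (1 + 1)) M M) (x : Fin 2 → M) :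
    (PseudoProd.perm (splitPerm (q := 1 + 1) (m := 0) rfl 1) (PseudoProd.compFirst t f)).1 x =
      PseudoTensor.map E (f.1 x) := by
  rw [PseudoProd.perm_apply]
  change PseudoTensor.perm k H _ (PseudoProd.substFirst t _ (f.1 _)) = _
  have hx : (fun a : Fin (1 + 1) => x (splitPerm (q := 1 + 1) (m := 0) rfl 1 (Sum.inl a))) = x := by
    ext i; fin_cases i <;> rfl
  rw [hx]
  induction f.1 x using PseudoTensor.induction_on with
  | h0 => simp
  | hmk F a =>
    rw [PseudoProd.substFirst_mk, ht, PseudoTensor.map_mk, PseudoTensor.expand, PseudoTensor.perm,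
      PseudoTensor.baseMap_mk, map_one, PseudoTensor.smul_mk, mul_one, PseudoTensor.baseMap_mk,
      Fin.cons_zero]
    -- What is left is that embedding F into the slots `Fin 2 ⊕ Fin 0` and renaming them back to
    -- `Fin 2` does nothing; simple tensors suffice.
    congr 1
    induction F using PiTensorProduct.induction_on with
    | smul_tprod c y =>
      rw [map_smul, map_smul, PseudoProd.place_inl_tprod, permTensor_tprod]
      congr 2
      ext i; fin_cases i <;> rfl
    | add a b ha hb => rw [map_add, map_add, ha, hb]
  | hadd a b ha hb => rw [map_add, map_add, ha, hb, map_add]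

/-- The bracket of a binary pseudoproduct with an `H`-linear map. -/
theorem nr_unary_apply {E : M →ₗ[H] M} {t : PseudoProd k H (Fin (0 + 1)) M M}
    (ht : ∀ x, t.1 x = PseudoTensor.mk k H 1 (E (x 0)))
    (f : PseudoProd k H (Fin (1 + 1)) M M) (x : Fin 2 → M) :
    (nr f t).1 x = f.1 ![E (x 0), x 1] -
      PseudoTensor.perm k H (Equiv.swap (0 : Fin 2) 1) (f.1 ![E (x 1), x 0]) -
        PseudoTensor.map E (f.1 x) := by
  have h1 : (circ (n := 2) rfl f t).1 x = f.1 ![E (x 0), x 1] -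
      PseudoTensor.perm k H (Equiv.swap (0 : Fin 2) 1) (f.1 ![E (x 1), x 0]) := by
    have h2 : PseudoTensor.perm k H (1 : Equiv.Perm (Fin 2)) (f.1 ![E (x 0), x 1]) =
        f.1 ![E (x 0), x 1] := PseudoTensor.perm_refl _
    simp only [circ, zero_add]
    -- Both permutations of two letters are (1,1)-shuffles, the transposition contributing the minus
    -- sign.
    rw [filter_isShuffle_one_one, Finset.sum_pair (by decide)]
    change (Equiv.Perm.sign (1 : Equiv.Perm (Fin 2)) : ℤ) •
        (PseudoProd.perm (splitPerm (q := 0 + 1) (m := 1) rfl 1) (PseudoProd.compFirst f t)).1 x +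
      (Equiv.Perm.sign (Equiv.swap (0 : Fin 2) 1) : ℤ) •
        (PseudoProd.perm (splitPerm (q := 0 + 1) (m := 1) rfl (Equiv.swap (0 : Fin 2) 1))
          (PseudoProd.compFirst f t)).1 x = _
    rw [perm_compFirst_unary ht, perm_compFirst_unary ht, Equiv.Perm.sign_swap (by decide)]
    simp only [Equiv.Perm.coe_one, id_eq, h2, Equiv.Perm.sign_one, Units.val_one, one_smul,
      Units.val_neg, neg_smul, Equiv.swap_apply_left, Equiv.swap_apply_right, sub_eq_add_neg]
  have h3 : (circ (n := 2) rfl t f).1 x = PseudoTensor.map E (f.1 x) := by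
    simp only [circ, Nat.reduceAdd]
    rw [filter_isShuffle_two_zero, Finset.sum_singleton, Equiv.Perm.sign_one, Units.val_one,
      one_smul]
    exact perm_unary_compFirst ht f x
  -- A one-argument map has degree 0, so the sign in the bracket is +1.
  change (circ (n := 2) rfl f t).1 x - ((-1 : ℤ) ^ (1 * 0) • circ (n := 2) rfl t f).1 x = _
  rw [mul_zero, pow_zero, one_smul, h1, h3]

/-- Skew-symmetry of a binary pseudoproduct, in terms of pairs. -/
def PairSkew (f : PseudoProd k H (Fin (1 + 1)) M M) : Prop :=
  ∀ a b, f.1 ![a, b] = -PseudoTensor.perm k H (Equiv.swap (0 : Fin 2) 1) (f.1 ![b, a])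

theorem PairSkew.add {f f' : PseudoProd k H (Fin (1 + 1)) M M} (hf : PairSkew f)
    (hf' : PairSkew f') : PairSkew (f + f') := by
  intro a b
  change f.1 ![a, b] + f'.1 ![a, b] = -PseudoTensor.perm k H _ (f.1 ![b, a] + f'.1 ![b, a])
  rw [map_add, neg_add, ← hf, ← hf']

theorem IsSkew.pairSkew {f : PseudoProd k H (Fin 2) M M} (hf : IsSkew f) : PairSkew f := by
  intro a b
  conv_lhs => rw [hf (Equiv.swap 0 1), Equiv.Perm.sign_swap (by decide)]
  rw [Units.val_neg, Units.val_one, neg_smul, one_smul]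
  change -(PseudoTensor.perm k H _ (f.1 _)) = _
  congr 3
  ext i
  fin_cases i <;> rfl

/-- Skew-symmetry of `f` turns the transposed term of the circle product into f(a, Eb). The bracket
thus measures how far E is from being a derivation of `f`. -/
theorem nr_unary_pair {E : M →ₗ[H] M} {t : PseudoProd k H (Fin (0 + 1)) M M}
    (ht : ∀ x, t.1 x = PseudoTensor.mk k H 1 (E (x 0)))
    {f : PseudoProd k H (Fin (1 + 1)) M M} (hf : PairSkew f) (a b : M) :
    (nr f t).1 ![a, b] = f.1 ![E a, b] + f.1 ![a, E b] - PseudoTensor.map E (f.1 ![a, b]) := by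
  rw [nr_unary_apply ht, hf a (E b), ← sub_eq_add_neg]
  rfl

/-- The swap exchanges the two terms with E inside and commutes with id ⊗_H E. This is what allows
`nr_unary_pair` to be applied to nested brackets. -/
theorem PairSkew.nr_unary {E : M →ₗ[H] M} {t : PseudoProd k H (Fin (0 + 1)) M M}
    (ht : ∀ x, t.1 x = PseudoTensor.mk k H 1 (E (x 0)))
    {f : PseudoProd k H (Fin (1 + 1)) M M} (hf : PairSkew f) : PairSkew (nr f t) := by
  intro a b
  rw [nr_unary_pair ht hf, nr_unary_pair ht hf, map_sub, map_add, ← PseudoTensor.map_perm,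
    hf (E a) b, hf a (E b), hf a b, map_neg]
  abel

end Unary

/-! ### Lifts to g ⊞ h and their skew-symmetry -/

namespace QuasiTwilled
variable {k H g h : Type*} [Field k] [Ring H] [HopfAlgebra k H] [Coalgebra.IsCocomm k H]
  [AddCommGroup g] [Module k g] [Module H g] [IsScalarTower k H g]
  [AddCommGroup h] [Module k h] [Module H h] [IsScalarTower k H h]
  (Q : QuasiTwilled k H g h)

theorem bracket_pairSkew : PairSkew Q.bracket := Q.skew.pairSkew

/-- The lift of `T : h → g` to an endomorphism of `g ⊞ h`. -/
def hatHom (T : h →ₗ[H] g) : g × h →ₗ[H] g × h :=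
  LinearMap.inl H g h ∘ₗ T ∘ₗ LinearMap.snd H g h

theorem hat_ofHom_apply (T : h →ₗ[H] g) (x : Fin 1 → g × h) :
    (hat (ofHom (k := k) T)).1 x = PseudoTensor.mk k H 1 (hatHom T (x 0)) := rfl

/-- Both arguments come from the same summand, so skew-symmetry of the full pseudobracket survives
projection. The same holds for `theta` and `mu`; for `eta` and `rho` the arguments lie in different
summands, and skew-symmetry appears only after lifting. -/
theorem pi_skew (x y : g) :
    Q.pi.1 x y = -PseudoTensor.perm k H (Equiv.swap (0 : Fin 2) 1) (Q.pi.1 y x) := by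
  change PseudoTensor.map (LinearMap.fst H g h) (Q.bracket.1 ![LinearMap.inl H g h _, _]) =
    -PseudoTensor.perm k H _ (PseudoTensor.map (LinearMap.fst H g h) (Q.bracket.1 ![_, _]))
  rw [← PseudoTensor.map_perm, ← map_neg, ← Q.bracket_pairSkew]

theorem theta_skew (x y : g) :
    Q.theta.1 x y = -PseudoTensor.perm k H (Equiv.swap (0 : Fin 2) 1) (Q.theta.1 y x) := by
  change PseudoTensor.map (LinearMap.snd H g h) (Q.bracket.1 ![LinearMap.inl H g h _, _]) =
    -PseudoTensor.perm k H _ (PseudoTensor.map (LinearMap.snd H g h) (Q.bracket.1 ![_, _]))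
  rw [← PseudoTensor.map_perm, ← map_neg, ← Q.bracket_pairSkew]

theorem mu_skew (u v : h) :
    Q.mu.1 u v = -PseudoTensor.perm k H (Equiv.swap (0 : Fin 2) 1) (Q.mu.1 v u) := by
  change PseudoTensor.map (LinearMap.snd H g h) (Q.bracket.1 ![LinearMap.inr H g h _, _]) =
    -PseudoTensor.perm k H _ (PseudoTensor.map (LinearMap.snd H g h) (Q.bracket.1 ![_, _]))
  rw [← PseudoTensor.map_perm, ← map_neg, ← Q.bracket_pairSkew]

theorem piHat_apply (a b : g × h) :
    Q.piHat.1 ![a, b] = PseudoTensor.map (LinearMap.inl H g h) (Q.pi.1 a.1 b.1) := rfl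

theorem thetaHat_apply (a b : g × h) :
    Q.thetaHat.1 ![a, b] = PseudoTensor.map (LinearMap.inr H g h) (Q.theta.1 a.1 b.1) := rfl

theorem muHat_apply (a b : g × h) :
    Q.muHat.1 ![a, b] = PseudoTensor.map (LinearMap.inr H g h) (Q.mu.1 a.2 b.2) := rfl

theorem etaHat_apply (a b : g × h) :
    Q.etaHat.1 ![a, b] = PseudoTensor.map (LinearMap.inl H g h) (Q.eta.1 a.1 b.2 -
      PseudoTensor.perm k H (Equiv.swap (0 : Fin 2) 1) (Q.eta.1 b.1 a.2)) := by
  rw [map_sub, PseudoTensor.map_perm]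
  rfl

theorem rhoHat_apply (a b : g × h) :
    Q.rhoHat.1 ![a, b] = PseudoTensor.map (LinearMap.inr H g h) (Q.rho.1 a.1 b.2 -
      PseudoTensor.perm k H (Equiv.swap (0 : Fin 2) 1) (Q.rho.1 b.1 a.2)) := by
  rw [map_sub, PseudoTensor.map_perm]
  rfl

theorem piHat_pairSkew : PairSkew Q.piHat := by
  intro a b
  rw [piHat_apply, piHat_apply, ← PseudoTensor.map_perm, ← map_neg, ← pi_skew]

theorem thetaHat_pairSkew : PairSkew Q.thetaHat := by
  intro a b
  rw [thetaHat_apply, thetaHat_apply, ← PseudoTensor.map_perm, ← map_neg, ← theta_skew]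

theorem muHat_pairSkew : PairSkew Q.muHat := by
  intro a b
  rw [muHat_apply, muHat_apply, ← PseudoTensor.map_perm, ← map_neg, ← mu_skew]

/-- The lift is antisymmetrised by construction: the swap is an involution and exchanges its two
terms up to sign. `rhoHat` behaves in the same way. -/
theorem etaHat_pairSkew : PairSkew Q.etaHat := by
  intro a b
  rw [etaHat_apply, etaHat_apply, ← PseudoTensor.map_perm, ← map_neg,
    map_sub (PseudoTensor.perm k H (Equiv.swap (0 : Fin 2) 1)), PseudoTensor.perm_swap_swap, neg_sub]

theorem rhoHat_pairSkew : PairSkew Q.rhoHat := by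
  intro a b
  rw [rhoHat_apply, rhoHat_apply, ← PseudoTensor.map_perm, ← map_neg,
    map_sub (PseudoTensor.perm k H (Equiv.swap (0 : Fin 2) 1)), PseudoTensor.perm_swap_swap, neg_sub]

/-- The lift of a map h → g vanishes on g. Hence values in g, those of `piHat` and `etaHat` among
them, are killed by an outer application, and so are values to which such a lift was already
applied. -/
theorem map_hatHom_inl {ι : Type*} [DecidableEq ι] [Fintype ι] (T : h →ₗ[H] g)
    (z : PseudoTensor k H ι g) :
    PseudoTensor.map (hatHom T) (PseudoTensor.map (LinearMap.inl H g h) z) = 0 := by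
  rw [PseudoTensor.map_map, show hatHom T ∘ₗ LinearMap.inl H g h = 0 by ext x <;> simp [hatHom],
    PseudoTensor.map_zero_left]

theorem map_hatHom_inr {ι : Type*} [DecidableEq ι] [Fintype ι] (T : h →ₗ[H] g)
    (z : PseudoTensor k H ι h) :
    PseudoTensor.map (hatHom T) (PseudoTensor.map (LinearMap.inr H g h) z) =
      PseudoTensor.map (LinearMap.inl H g h) (PseudoTensor.map T z) := by
  rw [PseudoTensor.map_map, PseudoTensor.map_map]
  rfl

/-- The projection to g induces a left inverse, so vanishing may be tested after inclusion into g ⊞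
h. -/
theorem map_inl_injective :
    Function.Injective (PseudoTensor.map (k := k) (ι := Fin 2) (LinearMap.inl H g h)) := by
  refine Function.LeftInverse.injective (g := PseudoTensor.map (LinearMap.fst H g h)) fun z => ?_
  rw [PseudoTensor.map_map, LinearMap.fst_comp_inl, PseudoTensor.map_id]

/-! ### The operations l_1, l_2, l_3 on degree-zero cochains -/

theorem hatHom_fst (T : h →ₗ[H] g) (a : g × h) : (hatHom T a).1 = T a.2 := rfl

theorem hatHom_snd (T : h →ₗ[H] g) (a : g × h) : (hatHom T a).2 = 0 := rfl

/-- Inside `muHat` an inserted S dies, having no h-component; inside `etaHat` it survives only in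
the g-argument. An outer S kills `etaHat` and keeps `muHat`. -/
theorem l1_ofHom_apply (S : h →ₗ[H] g) (a b : g × h) :
    (Q.l1 (ofHom S)).1 ![a, b] = PseudoTensor.map (LinearMap.inl H g h)
      (Q.eta.1 (S a.2) b.2 - PseudoTensor.perm k H (Equiv.swap (0 : Fin 2) 1)
        (Q.eta.1 (S b.2) a.2) - PseudoTensor.map S (Q.mu.1 a.2 b.2)) := by
  have e (a b : g × h) : (Q.muHat + Q.etaHat).1 ![a, b] = Q.muHat.1 ![a, b] + Q.etaHat.1 ![a, b] :=
    rfl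
  rw [l1, nr_unary_pair (hat_ofHom_apply S) (Q.muHat_pairSkew.add Q.etaHat_pairSkew)]
  simp only [e, muHat_apply, etaHat_apply, hatHom_fst, hatHom_snd, map_add, map_sub,
    map_hatHom_inl, map_hatHom_inr, map_zero, LinearMap.zero_apply]
  abel

/-- A term in `pi` survives when S and S' fill its two arguments, one each. A term in `rho` survives
when one of them fills the g-argument and the other is applied outside, which carries the value from
h to g. -/
theorem l2_ofHom_apply (S S' : h →ₗ[H] g) (a b : g × h) :
    (Q.l2 (ofHom S) (ofHom S')).1 ![a, b] = PseudoTensor.map (LinearMap.inl H g h)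
      (Q.pi.1 (S a.2) (S' b.2) + Q.pi.1 (S' a.2) (S b.2) -
        PseudoTensor.map S (Q.rho.1 (S' a.2) b.2 -
          PseudoTensor.perm k H (Equiv.swap (0 : Fin 2) 1) (Q.rho.1 (S' b.2) a.2)) -
        PseudoTensor.map S' (Q.rho.1 (S a.2) b.2 -
          PseudoTensor.perm k H (Equiv.swap (0 : Fin 2) 1) (Q.rho.1 (S b.2) a.2))) := by
  have e (a b : g × h) : (Q.piHat + Q.rhoHat).1 ![a, b] = Q.piHat.1 ![a, b] + Q.rhoHat.1 ![a, b] :=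
    rfl
  have hs := Q.piHat_pairSkew.add Q.rhoHat_pairSkew
  rw [l2, nr_unary_pair (hat_ofHom_apply S') (hs.nr_unary (hat_ofHom_apply S))]
  simp only [nr_unary_pair (hat_ofHom_apply S) hs, e, piHat_apply, rhoHat_apply, hatHom_fst,
    hatHom_snd, map_add, map_sub, map_hatHom_inl, map_hatHom_inr, map_zero, LinearMap.zero_apply]
  abel

/-- Two maps must fill the g-arguments of `theta` and the third is applied outside: three choices of
the outer map, two orders of the inner ones. The single outer application produces the common minus
sign. -/
theorem l3_ofHom_apply (S S' S'' : h →ₗ[H] g) (a b : g × h) :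
    (Q.l3 (ofHom S) (ofHom S') (ofHom S'')).1 ![a, b] = -PseudoTensor.map (LinearMap.inl H g h)
      (PseudoTensor.map S (Q.theta.1 (S' a.2) (S'' b.2) + Q.theta.1 (S'' a.2) (S' b.2)) +
        PseudoTensor.map S' (Q.theta.1 (S a.2) (S'' b.2) + Q.theta.1 (S'' a.2) (S b.2)) +
        PseudoTensor.map S'' (Q.theta.1 (S a.2) (S' b.2) + Q.theta.1 (S' a.2) (S b.2))) := by
  have h1 := Q.thetaHat_pairSkew.nr_unary (hat_ofHom_apply S)
  have h2 := h1.nr_unary (hat_ofHom_apply S')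
  rw [l3, nr_unary_pair (hat_ofHom_apply S'') h2]
  simp only [nr_unary_pair (hat_ofHom_apply S') h1,
    nr_unary_pair (hat_ofHom_apply S) Q.thetaHat_pairSkew, thetaHat_apply, hatHom_fst,
    hatHom_snd, map_add, map_sub, map_hatHom_inl, map_hatHom_inr, map_zero, LinearMap.zero_apply]
  abel

/-! ### Taylor expansion of the defect -/

/-- The defect of `S : h → g` from being a deformation map of type II. -/
def defect (S : h →ₗ[H] g) (u v : h) : PseudoTensor k H (Fin 2) g :=
  Q.pi.1 (S u) (S v) + Q.eta.1 (S u) v -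
      PseudoTensor.perm k H (Equiv.swap (0 : Fin 2) 1) (Q.eta.1 (S v) u) -
    PseudoTensor.map S (Q.rho.1 (S u) v -
      PseudoTensor.perm k H (Equiv.swap (0 : Fin 2) 1) (Q.rho.1 (S v) u) +
      Q.mu.1 u v + Q.theta.1 (S u) (S v))

theorem isDMap_iff_defect (S : h →ₗ[H] g) : Q.IsDMap S ↔ ∀ u v, Q.defect S u v = 0 := by
  simp only [IsDMap, defect, sub_eq_zero]

/-- This is the expansion of the cubic map S ↦ `defect S` around T. The part linear in T' is l_1^T,
and the quadratic and cubic parts are l_2^T/2! and l_3^T/3!. No equation on T is imposed, so the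
constant term `defect T` is subtracted on the right. -/
theorem twisted_apply [CharZero k] (T T' : h →ₗ[H] g) (a b : g × h) :
    (Q.l1T (ofHom T) (ofHom T') + (1 / (Nat.factorial 2 : k)) •
        Q.l2T (ofHom T) (ofHom T') (ofHom T') + (1 / (Nat.factorial 3 : k)) •
        Q.l3T (ofHom T) (ofHom T') (ofHom T') (ofHom T')).1 ![a, b] =
      PseudoTensor.map (LinearMap.inl H g h)
        (Q.defect (T + T') a.2 b.2 - Q.defect T a.2 b.2) := by
  change ((Q.l1 (ofHom T')).1 ![a, b] + (Q.l2 (ofHom T) (ofHom T')).1 ![a, b] +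
      (1 / 2 : k) • (Q.l3 (ofHom T) (ofHom T) (ofHom T')).1 ![a, b]) +
    (1 / (Nat.factorial 2 : k)) • ((Q.l2 (ofHom T') (ofHom T')).1 ![a, b] +
      (Q.l3 (ofHom T) (ofHom T') (ofHom T')).1 ![a, b]) +
    (1 / (Nat.factorial 3 : k)) • (Q.l3 (ofHom T') (ofHom T') (ofHom T')).1 ![a, b] = _
  have e2 : (Nat.factorial 2 : k) = 2 := by norm_num [Nat.factorial]
  have e3 : (Nat.factorial 3 : k) = 6 := by norm_num [Nat.factorial]
  rw [e2, e3]
  simp only [l1_ofHom_apply, l2_ofHom_apply, l3_ofHom_apply, defect, LinearMap.add_apply, map_add,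
    map_sub, PseudoTensor.map_add_left]
  -- Equal terms occur two or six times, for instance six copies of T'θ(T',T') in l_3(T',T',T') when
  -- a = b is not assumed but all three maps agree; in characteristic 0 these multiplicities cancel
  -- 1/2 and 1/6.
  module

end QuasiTwilled
end
end PseudoAlg

/-! ### The equivalence -/

theorem theorem4p17 {k H g h : Type*} [Field k] [CharZero k]
    [Ring H] [HopfAlgebra k H] [Coalgebra.IsCocomm k H]
    [AddCommGroup g] [Module k g] [Module H g] [IsScalarTower k H g]
    [AddCommGroup h] [Module k h] [Module H h] [IsScalarTower k H h]
    (Q : PseudoAlg.QuasiTwilled k H g h) (T : h →ₗ[H] g) (hT : Q.IsDMap T) (T' : h →ₗ[H] g) :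
    Q.IsDMap (T + T') ↔
      Q.IsTwistedMC (PseudoAlg.ofHom T) (PseudoAlg.ofHom T') := by
  rw [Q.isDMap_iff_defect] at hT ⊢
  constructor
  · intro hS
    refine Subtype.ext (MultilinearMap.ext fun x => ?_)
    have hx : x = ![x 0, x 1] := by ext i <;> fin_cases i <;> rfl
    rw [hx, Q.twisted_apply T T' (x 0) (x 1), hS, hT, sub_zero, map_zero]
    rfl
  · intro hMC u v
    -- Only the h-components enter the expansion, so arguments from h recover the defect at every
    -- pair u, v.
    have h1 := Q.twisted_apply T T' (0, u) (0, v)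
    rw [show _ = (0 : PseudoAlg.PseudoProd k H (Fin 2) (g × h) (g × h)) from hMC] at h1
    have h2 := PseudoAlg.QuasiTwilled.map_inl_injective (h1.symm.trans (map_zero _).symm)
    rwa [hT, sub_zero] at h2
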